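/- **Setting.** Let $\lambda_1^*,\dots,\lambda_n^*$ be complex numbers ordered so that $\lambda^*_{2j-1}=a_j+b_j\mathrm i$, $\lambda^*_{2j}=a_j-b_j\mathrm i$ with $a_j,b_j\in\mathbb R$, $b_j\ne0$ for $j=1,\dots,s$ ($2s\le n$), and $\lambda_j^*\in\mathbb R$ for $j>2s$. Let $\Lambda=\mathrm{diag}(\mathrm{Re}\,\lambda_1^*,\dots,\mathrm{Re}\,\lambda_n^*)$, $\mathcal I_1=\{(i,j):i\ge j\}$, $\mathcal I_2=\{(2k-1,2k):k=1,\dots,s\}$. Write $\langle A,B\rangle_F=\mathrm{tr}(A^TB)$, $\|A\|_F^2=\langle A,A\rangle_F$, $\mathbf e=(1,\dots,1)^T$, and $\odot$, $\oslash$ for the entrywise product and quotient. Put - $\mathbb{DP}_n=\{C\in\mathbb R^{n\times n}: c_{ij}>0,\ C\mathbf e=\mathbf e,\ C^T\mathbf e=\mathbf e\}$ and $\mathcal O(n)=\{Q: Q^TQ=I_n\}$, - $\mathcal W=\{W: w_{ij}=0\text{ for }(i,j)\notin\mathcal I_2,\ w_{ij}>0\text{ for }(i,j)\in\mathcal I_2\}$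 and $\mathcal V=\{V: v_{ij}=0\text{ for }(i,j)\in\mathcal I_1\cup\mathcal I_2\}$, and $\mathcal Z=\mathbb{DP}_n\times\mathcal O(n)\times\mathcal W\times\mathcal V$, with the topology induced from $(\mathbb R^{n\times n})^4$. For $W\in\mathcal W$ let $(\mathcal A(W))_{ij}=-b_{i/2}^2/w_{ji}$ if $(j,i)\in\mathcal I_2$ and $0$ otherwise. Define $F:\mathcal Z\to\mathbb R^{n\times n}$ and $f:\mathcal Z\to\mathbb R$ by $$F(C,Q,W,V)=C-Q(\Lambda+\mathcal A(W)+W+V)Q^T,\qquad f(Z)=\tfrac12\|F(Z)\|_F^2 .$$ The tangent space $T_Z\mathcal Z$ at $Z=(C,Q,W,V)$ consists of the $(\xi_C,\xi_Q,\xi_W,\xi_V)$ with $\xi_C\mathbf e=0$, $\xi_C^T\mathbf e=0$; $\xi_Q=QK$, $K^T=-K$; $(\xi_W)_{ij}=0$ for $(i,j)\notin\mathcal I_2$; $\xi_V\in\mathcal V$. It carries the Riemannian metric $$\langle\xi,\eta\rangle=\sum_{i,j}\frac{(\xi_C)_{ij}(\eta_C)_{ij}}{c_{ij}}+\mathrm{tr}(\xi_Q^T\eta_Q)+\sum_{(i,j)\in\mathcal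 I_2}\frac{(\xi_W)_{ij}(\eta_W)_{ij}}{w_{ij}}+\mathrm{tr}(\xi_V^T\eta_V).$$ $DF(Z):T_Z\mathcal Z\to\mathbb R^{n\times n}$ is the differential of $F$, $DF(Z)^*$ is its adjoint with respect to this metric and $\langle\cdot,\cdot\rangle_F$, and $\mathrm{grad} f$ is the Riemannian gradient of $f$. The retraction is $R_Z(\xi)=\bigl(\mathcal P(C\odot\exp(\xi_C\oslash C)),\ \mathrm{qf}(Q+\xi_Q),\ R_W(\xi_W),\ V+\xi_V\bigr)$, where $\exp$ acts entrywise; $\mathcal P(M)$, for $M$ entrywise positive, is the doubly stochastic matrix $D_1MD_2$ with positive diagonal $D_1,D_2$ (unique, by Sinkhorn's theorem; it is the limit of the Sinkhorn–Knopp algorithm); $\mathrm{qf}(M)$ is the orthogonal factor of the QR decomposition of the nonsingular matrix $M$ whose triangular factor has positive diagonal; and $(R_W(\xi_W))_{ij}=w_{ij}\exp((\xi_W)_{ij}/w_{ij})$ for $(i,j)\in\mathcal I_2$ and $0$ otherwise. **Algorithm (nonmonotone Riemannian inexact Newton-CG method).** Choose $Z_0\in\mathcal Z$, $\epsilon\ge0$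 (for $\epsilon=0$ the stopping test is never passed), $\tau,\rho,\overline\sigma_{\max}\in(0,1)$, $\delta\in(0,\frac12)$, and positive sequences $\eta_k\to0$ and $\gamma_k$ with $\sum_k\gamma_k<\infty$. For $k=0,1,2,\dots$: 1. If $\|F(Z_k)\|_F<\epsilon$, stop. 2. Let $\overline\sigma_k=\min\{\overline\sigma_{\max},\|F(Z_k)\|_F\}$, $\overline\eta_k=\min\{\eta_k,\|F(Z_k)\|_F\}$. Take any $\Delta Y_k\in\mathbb R^{n\times n}$ (found, for instance, by the conjugate gradient method) with $$\bigl\|(DF(Z_k)\circ DF(Z_k)^*+\overline\sigma_k\,\mathrm{id})[\Delta Y_k]+F(Z_k)\bigr\|_F\le\overline\eta_k\|F(Z_k)\|_F$$ and set $\Delta Z_k=DF(Z_k)^*[\Delta Y_k]$. 3. If $\|F(R_{Z_k}(\Delta Z_k))\|_F\le\tau\|F(Z_k)\|_F$, set $\alpha_k=1$. Otherwise let $\alpha_k$ be the largest element of $\{\rho^l:l=0,1,2,\dots\}$ such that $$\|F(R_{Z_k}(\alpha_k\Delta Z_k))\|_F^2-\|F(Z_k)\|_F^2\le-\delta\alpha_k^2\,|\langle\mathrm{grad}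 f(Z_k),\Delta Z_k\rangle|+\gamma_k\|F(Z_k)\|_F^2 .$$ Set $Z_{k+1}=R_{Z_k}(\alpha_k\Delta Z_k)$. **Theorem.** Suppose this algorithm generates an infinite sequence $\{Z_k\}\subset\mathcal Z$. Then every accumulation point $Z_*\in\mathcal Z$ of $\{Z_k\}$ is a stationary point of $f$, that is, $\mathrm{grad} f(Z_*)=DF(Z_*)^*[F(Z_*)]=0$. -/

import Mathlib

open scoped Matrix Matrix.Norms.Frobenius
open Filter Topology

noncomputable section

namespace PDStIEP

/-- Real `n × n` matrices; the norm in force is the Frobenius norm. -/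
abbrev Mat (n : ℕ) := Matrix (Fin n) (Fin n) ℝ

/-- The Frobenius inner product `tr (Aᵀ B)` as a bilinear form. -/
def frob (n : ℕ) : LinearMap.BilinForm ℝ (Mat n) :=
  LinearMap.mk₂ ℝ (fun A B => (Aᵀ * B).trace)
    (fun A A' B => by simp [add_mul])
    (fun c A B => by simp)
    (fun A B B' => by simp [mul_add])
    (fun c A B => by simp)

/-- The prescribed list of `n` complex numbers, closed under complex conjugation and ordered so that
its first `2 s` members are the conjugate pairs of non-real numbers. With indices starting from `0`,
the `k`-th pair is `eig (2 k) = a + b i`, `eig (2 k + 1) = a - b i`, `b ≠ 0`. -/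
structure Spectrum (n : ℕ) where
  s : ℕ
  two_mul_s_le : 2 * s ≤ n
  eig : Fin n → ℂ
  pair : ∀ (k : ℕ) (hk : k < s),
    (eig ⟨2 * k, by omega⟩).im ≠ 0 ∧
      eig ⟨2 * k + 1, by omega⟩ = (starRingEnd ℂ) (eig ⟨2 * k, by omega⟩)
  real : ∀ i : Fin n, 2 * s ≤ (i : ℕ) → (eig i).im = 0

variable {n : ℕ} (S : Spectrum n)

/-- The index set `I₁`: diagonal and strictly lower triangular positions. -/
def I1 (i j : Fin n) : Prop := j ≤ i

/-- The index set `I₂`: the upper right corners of the leading `s` diagonal blocks of size two. -/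
def I2 (i j : Fin n) : Prop := ∃ k < S.s, (i : ℕ) = 2 * k ∧ (j : ℕ) = 2 * k + 1

/-- The (block) diagonal matrix `Λ` of the real parts of the prescribed numbers. -/
def Lam : Mat n := Matrix.diagonal fun i => (S.eig i).re

open Classical in
/-- `(A(W))ᵢⱼ = - b² / wⱼᵢ` for `(j, i) ∈ I₂` and `0` otherwise, where `b` is (up to sign) the
imaginary part of the `i`-th prescribed number. -/
def opA (W : Mat n) : Mat n :=
  Matrix.of fun i j => if I2 S j i then -((S.eig i).im ^ 2) / W j i else 0

/-- Positive doubly stochastic matrices. -/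
def DP (n : ℕ) : Set (Mat n) :=
  {C | (∀ i j, 0 < C i j) ∧ (∀ i, ∑ j, C i j = 1) ∧ (∀ j, ∑ i, C i j = 1)}

/-- Orthogonal matrices. -/
def On (n : ℕ) : Set (Mat n) := {Q | Qᵀ * Q = 1}

/-- The set `𝒲`. -/
def calW : Set (Mat n) :=
  {W | (∀ i j, ¬ I2 S i j → W i j = 0) ∧ (∀ i j, I2 S i j → 0 < W i j)}

/-- The set `𝒱`. -/
def calV : Set (Mat n) := {V | ∀ i j, I1 i j ∨ I2 S i j → V i j = 0}

/-- The ambient space of quadruples `(C, Q, W, V)` of matrices. -/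
abbrev Amb (n : ℕ) := Mat n × Mat n × Mat n × Mat n

/-- The set `DP_n × O(n) × 𝒲 × 𝒱`. -/
def ZSet : Set (Amb n) := DP n ×ˢ On n ×ˢ calW S ×ˢ calV S

/-- The manifold `𝒵 = DP_n × O(n) × 𝒲 × 𝒱`, with the topology induced by the ambient space. -/
abbrev ZMan := ZSet S

/-- The mapping `F`, given by its formula on the whole ambient space. -/
def F (Z : Amb n) : Mat n :=
  Z.1 - Z.2.1 * (Lam S + opA S Z.2.2.1 + Z.2.2.1 + Z.2.2.2) * Z.2.1ᵀ

/-- The merit function `f = ½ ‖F‖²`. -/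
def merit (Z : Amb n) : ℝ := 1 / 2 * ‖F S Z‖ ^ 2

/-! ### Tangent spaces -/

/-- The tangent space of `DP_n` (the same at all points): zero row and column sums. -/
def tanDP (n : ℕ) : Submodule ℝ (Mat n) where
  carrier := {ξ | (∀ i, ∑ j, ξ i j = 0) ∧ (∀ j, ∑ i, ξ i j = 0)}
  add_mem' := fun ha hb =>
    ⟨fun i => by simp [Finset.sum_add_distrib, ha.1 i, hb.1 i],
      fun j => by simp [Finset.sum_add_distrib, ha.2 j, hb.2 j]⟩
  zero_mem' := by simp
  smul_mem' := fun c a ha =>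
    ⟨fun i => by simp [← Finset.mul_sum, ha.1 i], fun j => by simp [← Finset.mul_sum, ha.2 j]⟩

/-- The tangent space `{Q K | Kᵀ = -K}` of `O(n)` at `Q`. -/
def tanOn (Q : Mat n) : Submodule ℝ (Mat n) where
  carrier := {ξ | ∃ K : Mat n, Kᵀ = -K ∧ ξ = Q * K}
  add_mem' := by
    rintro _ _ ⟨K, hK, rfl⟩ ⟨L, hL, rfl⟩
    exact ⟨K + L, by rw [Matrix.transpose_add, hK, hL]; abel, by rw [mul_add]⟩
  zero_mem' := ⟨0, by simp, by simp⟩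
  smul_mem' := by
    rintro c _ ⟨K, hK, rfl⟩
    exact ⟨c • K, by rw [Matrix.transpose_smul, hK, smul_neg], by simp⟩

/-- The tangent space of `𝒲` (the same at all points). -/
def tanW : Submodule ℝ (Mat n) where
  carrier := {ξ | ∀ i j, ¬ I2 S i j → ξ i j = 0}
  add_mem' := fun ha hb i j h => by simp [ha i j h, hb i j h]
  zero_mem' := by simp
  smul_mem' := fun c a ha i j h => by simp [ha i j h]

/-- The tangent space of `𝒱`, which is `𝒱` itself. -/
def tanV : Submodule ℝ (Mat n) where
  carrier := calV S
  add_mem' := fun ha hb i j h => by simp [ha i j h, hb i j h]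
  zero_mem' := by intro i j _; simp
  smul_mem' := fun c a ha i j h => by simp [ha i j h]

/-- The tangent space `T_Z 𝒵`. -/
def Tan (Z : ZMan S) : Submodule ℝ (Amb n) :=
  (tanDP n).prod ((tanOn Z.1.2.1).prod ((tanW S).prod (tanV S)))

/-! ### The Riemannian metric -/

open Classical in
/-- The Riemannian metric of `𝒵` at `Z = (C, Q, W, V)`: the Fisher metric on `DP_n` and on `𝒲`, the
Frobenius inner product on `O(n)` and on `𝒱`. -/
def metric (Z : ZMan S) : LinearMap.BilinForm ℝ (Tan S Z) :=
  LinearMap.mk₂ ℝ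
    (fun ξ η =>
      (∑ i, ∑ j, ξ.1.1 i j * η.1.1 i j / Z.1.1 i j)
        + frob n ξ.1.2.1 η.1.2.1
        + (∑ i, ∑ j, if I2 S i j then ξ.1.2.2.1 i j * η.1.2.2.1 i j / Z.1.2.2.1 i j else 0)
        + frob n ξ.1.2.2.2 η.1.2.2.2)
    (fun ξ ξ' η => by
      have h (p : Prop) [Decidable p] (a b : ℝ) :
          (if p then a + b else 0) = (if p then a else 0) + (if p then b else 0) := by
        split_ifs <;> simp
      simp [add_mul, add_div, Finset.sum_add_distrib, h]
      ring)
    (fun c ξ η => by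
      simp only [Submodule.coe_smul, Prod.smul_fst, Prod.smul_snd, Matrix.smul_apply, smul_eq_mul,
        map_smul, LinearMap.smul_apply, mul_add, Finset.mul_sum, mul_ite, mul_zero, mul_div_assoc,
        mul_assoc])
    (fun ξ η η' => by
      have h (p : Prop) [Decidable p] (a b : ℝ) :
          (if p then a + b else 0) = (if p then a else 0) + (if p then b else 0) := by
        split_ifs <;> simp
      simp [mul_add, add_div, Finset.sum_add_distrib, h]
      ring)
    (fun c ξ η => by
      simp only [Submodule.coe_smul, Prod.smul_fst, Prod.smul_snd, Matrix.smul_apply, smul_eq_mul,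
        map_smul, mul_add, Finset.mul_sum, mul_ite, mul_zero, mul_div_assoc, mul_left_comm])

open Classical in
theorem metric_apply (Z : ZMan S) (ξ η : Tan S Z) :
    metric S Z ξ η =
      (∑ i, ∑ j, ξ.1.1 i j * η.1.1 i j / Z.1.1 i j)
        + frob n ξ.1.2.1 η.1.2.1
        + (∑ i, ∑ j, if I2 S i j then ξ.1.2.2.1 i j * η.1.2.2.1 i j / Z.1.2.2.1 i j else 0)
        + frob n ξ.1.2.2.2 η.1.2.2.2 := rfl

theorem frob_self (A : Mat n) : frob n A A = ∑ i, ∑ j, A j i ^ 2 := by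
  simp [frob, Matrix.trace, Matrix.mul_apply, sq]

theorem frob_self_nonneg (A : Mat n) : 0 ≤ frob n A A := by
  rw [frob_self]; positivity

theorem eq_zero_of_frob_self (A : Mat n) (h : frob n A A = 0) : A = 0 := by
  rw [frob_self, Finset.sum_eq_zero_iff_of_nonneg (fun i _ => by positivity)] at h
  ext i j
  have h1 := h j (Finset.mem_univ _)
  rw [Finset.sum_eq_zero_iff_of_nonneg (fun i _ => by positivity)] at h1
  simpa using h1 i (Finset.mem_univ _)

theorem metric_definite (Z : ZMan S) (ξ : Tan S Z) (h : metric S Z ξ ξ = 0) : ξ = 0 := by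
  classical
  rw [metric_apply] at h
  obtain ⟨⟨hC, -, -⟩, -, ⟨-, hW⟩, -⟩ := Z.2
  have t1 : ∀ i j, 0 ≤ ξ.1.1 i j * ξ.1.1 i j / Z.1.1 i j := fun i j =>
    div_nonneg (mul_self_nonneg _) (hC i j).le
  have t3 : ∀ i j, 0 ≤
      (if I2 S i j then ξ.1.2.2.1 i j * ξ.1.2.2.1 i j / Z.1.2.2.1 i j else 0) := fun i j => by
    split_ifs with hij
    · exact div_nonneg (mul_self_nonneg _) (hW i j hij).le
    · exact le_rfl
  have s1 := Finset.sum_nonneg fun i (_ : i ∈ Finset.univ) =>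
    Finset.sum_nonneg fun j (_ : j ∈ Finset.univ) => t1 i j
  have s3 := Finset.sum_nonneg fun i (_ : i ∈ Finset.univ) =>
    Finset.sum_nonneg fun j (_ : j ∈ Finset.univ) => t3 i j
  have s2 := frob_self_nonneg ξ.1.2.1
  have s4 := frob_self_nonneg ξ.1.2.2.2
  have e1 : ∑ i, ∑ j, ξ.1.1 i j * ξ.1.1 i j / Z.1.1 i j = 0 := by linarith
  have e3 : (∑ i, ∑ j,
      if I2 S i j then ξ.1.2.2.1 i j * ξ.1.2.2.1 i j / Z.1.2.2.1 i j else 0) = 0 := by linarith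
  have z2 := eq_zero_of_frob_self ξ.1.2.1 (by linarith)
  have z4 := eq_zero_of_frob_self ξ.1.2.2.2 (by linarith)
  have z1 : ξ.1.1 = 0 := by
    ext i j
    rw [Finset.sum_eq_zero_iff_of_nonneg (fun i _ => Finset.sum_nonneg fun j _ => t1 i j)] at e1
    have := e1 i (Finset.mem_univ _)
    rw [Finset.sum_eq_zero_iff_of_nonneg (fun j _ => t1 i j)] at this
    have := this j (Finset.mem_univ _)
    have hne := (hC i j).ne'
    simpa [hne] using this
  have z3 : ξ.1.2.2.1 = 0 := by
    ext i j
    by_cases hij : I2 S i j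
    · rw [Finset.sum_eq_zero_iff_of_nonneg (fun i _ => Finset.sum_nonneg fun j _ => t3 i j)] at e3
      have := e3 i (Finset.mem_univ _)
      rw [Finset.sum_eq_zero_iff_of_nonneg (fun j _ => t3 i j)] at this
      have := this j (Finset.mem_univ _)
      have hne := (hW i j hij).ne'
      simpa [hij, hne] using this
    · exact ξ.2.2.2.1 i j hij
  exact Subtype.ext (Prod.ext z1 (Prod.ext z2 (Prod.ext z3 z4)))

theorem metric_nondegenerate (Z : ZMan S) : (metric S Z).Nondegenerate :=
  ⟨fun ξ h => metric_definite S Z ξ (h ξ), fun ξ h => metric_definite S Z ξ (h ξ)⟩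

/-! ### Differential, adjoint, gradient -/

/-- The differential `DF(Z) : T_Z 𝒵 → ℝⁿˣⁿ`. -/
def DF (Z : ZMan S) : Tan S Z →ₗ[ℝ] Mat n :=
  (fderiv ℝ (F S) Z.1 : Amb n →ₗ[ℝ] Mat n) ∘ₗ (Tan S Z).subtype

/-- The adjoint `(DF(Z))^* : ℝⁿˣⁿ → T_Z 𝒵` with respect to the Riemannian metric and the Frobenius
inner product. -/
def DFadj (Z : ZMan S) : Mat n →ₗ[ℝ] Tan S Z :=
  ((metric S Z).toDual (metric_nondegenerate S Z)).symm.toLinearMap ∘ₗ (DF S Z).dualMap ∘ₗ frob n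

theorem metric_DFadj (Z : ZMan S) (Y : Mat n) (η : Tan S Z) :
    metric S Z (DFadj S Z Y) η = frob n Y (DF S Z η) := by
  simp [DFadj]

/-- The Riemannian gradient of the merit function: the tangent vector that represents the
differential of `f` at `Z` in the Riemannian metric. -/
def gradf (Z : ZMan S) : Tan S Z :=
  ((metric S Z).toDual (metric_nondegenerate S Z)).symm
    ((fderiv ℝ (merit S) Z.1 : Amb n →ₗ[ℝ] ℝ) ∘ₗ (Tan S Z).subtype)

theorem metric_gradf (Z : ZMan S) (η : Tan S Z) :
    metric S Z (gradf S Z) η = fderiv ℝ (merit S) Z.1 η.1 := by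
  simp [gradf]

/-! ### The retraction -/

/-- `P` is the doubly stochastic matrix of the form `D₁ M D₂` with positive diagonal matrices `D₁`
and `D₂`. For an element-wise positive `M` there is exactly one such matrix (Sinkhorn's theorem). -/
def IsSinkhorn (M P : Mat n) : Prop :=
  P ∈ DP n ∧ ∃ r c : Fin n → ℝ, (∀ i, 0 < r i) ∧ (∀ j, 0 < c j) ∧
    P = Matrix.diagonal r * M * Matrix.diagonal c

/-- The Sinkhorn-Knopp mapping from element-wise positive to doubly stochastic matrices. -/
def sinkhorn (M : Mat n) : Mat n := Classical.epsilon (IsSinkhorn M)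

/-- `Q` is the orthogonal factor of a QR decomposition of `M` whose triangular factor has a positive
diagonal; it exists and is unique if `M` is nonsingular. -/
def IsQFactor (M Q : Mat n) : Prop :=
  Q ∈ On n ∧ ∃ R : Mat n, (∀ i j, j < i → R i j = 0) ∧ (∀ i, 0 < R i i) ∧ M = Q * R

/-- `qf M`, the Q factor of the QR decomposition of a nonsingular matrix. -/
def qf (M : Mat n) : Mat n := Classical.epsilon (IsQFactor M)

/-- The retraction on `DP_n`. -/
def retrDP (A ξ : Mat n) : Mat n :=
  sinkhorn (Matrix.of fun i j => A i j * Real.exp (ξ i j / A i j))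

/-- The retraction on `O(n)`. -/
def retrOn (Q ξ : Mat n) : Mat n := qf (Q + ξ)

open Classical in
/-- The retraction on `𝒲`. -/
def retrW (W ξ : Mat n) : Mat n :=
  Matrix.of fun i j => if I2 S i j then W i j * Real.exp (ξ i j / W i j) else 0

/-- The retraction `R_Z(ξ)` on `𝒵`. -/
def retr (Z : ZMan S) (ξ : Tan S Z) : Amb n :=
  (retrDP Z.1.1 ξ.1.1, retrOn Z.1.2.1 ξ.1.2.1, retrW S Z.1.2.2.1 ξ.1.2.2.1,
    Z.1.2.2.2 + ξ.1.2.2.2)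

/-! ### The algorithm -/

/-- The parameters of the nonmonotone Riemannian inexact Newton-CG method. For `ε = 0` the stopping
test is never passed. -/
structure Params where
  ε : ℝ
  τ : ℝ
  ρ : ℝ
  σmax : ℝ
  δ : ℝ
  η : ℕ → ℝ
  γ : ℕ → ℝ
  ε_nonneg : 0 ≤ ε
  τ_mem : τ ∈ Set.Ioo (0 : ℝ) 1
  ρ_mem : ρ ∈ Set.Ioo (0 : ℝ) 1
  σmax_mem : σmax ∈ Set.Ioo (0 : ℝ) 1
  δ_mem : δ ∈ Set.Ioo (0 : ℝ) (1 / 2)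
  η_pos : ∀ k, 0 < η k
  γ_pos : ∀ k, 0 < γ k
  η_tendsto : Tendsto η atTop (𝓝 0)
  γ_summable : Summable γ

variable (p : Params)

/-- The regularization parameter `σ̄_k` at the iterate `Z`. -/
def sigmaBar (Z : ZMan S) : ℝ := min p.σmax ‖F S Z.1‖

/-- The forcing parameter `η̄_k` at the iterate `Z`. -/
def etaBar (k : ℕ) (Z : ZMan S) : ℝ := min (p.η k) ‖F S Z.1‖

/-- `Y` is an admissible inexact solution, at the iterate `Z = Z_k`, of the regularized equation
`(DF(Z) ∘ DF(Z)^* + σ̄_k id)[Y] = - F(Z)`. -/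
def InexactSolution (k : ℕ) (Z : ZMan S) (Y : Mat n) : Prop :=
  ‖DF S Z (DFadj S Z Y) + sigmaBar S p Z • Y + F S Z.1‖ ≤ etaBar S p k Z * ‖F S Z.1‖

/-- The test `‖F(R_Z(ξ))‖ ≤ τ ‖F(Z)‖` for the full step. -/
def FullStep (Z : ZMan S) (ξ : Tan S Z) : Prop := ‖F S (retr S Z ξ)‖ ≤ p.τ * ‖F S Z.1‖

/-- The nonmonotone sufficient decrease condition for the stepsize `a`. -/
def Decrease (k : ℕ) (Z : ZMan S) (ξ : Tan S Z) (a : ℝ) : Prop :=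
  ‖F S (retr S Z (a • ξ))‖ ^ 2 - ‖F S Z.1‖ ^ 2 ≤
    -p.δ * a ^ 2 * |metric S Z (gradf S Z) ξ| + p.γ k * ‖F S Z.1‖ ^ 2

/-- The stepsize rule: `a = 1` if the full step passes its test, and otherwise `a` is the largest of
`1, ρ, ρ², …` that satisfies the decrease condition. -/
def IsStepsize (k : ℕ) (Z : ZMan S) (ξ : Tan S Z) (a : ℝ) : Prop :=
  (FullStep S p Z ξ → a = 1) ∧
    (¬ FullStep S p Z ξ → IsGreatest {t | (∃ l : ℕ, t = p.ρ ^ l) ∧ Decrease S p k Z ξ t} a)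

/-- The method with parameters `p` generates the infinite sequence `Z`: at no iterate is the stopping
test passed, and every iterate arises from the previous one by one pass of the method. -/
def Generates (Z : ℕ → ZMan S) : Prop :=
  ∀ k, ¬ ‖F S (Z k).1‖ < p.ε ∧
    ∃ (Y : Mat n) (a : ℝ), InexactSolution S p k (Z k) Y ∧
      IsStepsize S p k (Z k) (DFadj S (Z k) Y) a ∧
      (Z (k + 1)).1 = retr S (Z k) (a • DFadj S (Z k) Y)

end PDStIEP

end

noncomputable section

namespace PDStIEP

/-! ### The Frobenius norm -/

/-! The argument is a contradiction at an accumulation point `Z₀` with `F ≠ 0` there; if `F`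
vanishes, stationarity is trivial. Each step obeys `‖F(Z_{k+1})‖² ≤ (1 + γ_k) ‖F(Z_k)‖²` with
summable `γ`, so the whole sequence `‖F(Z_k)‖` converges, to the positive number `‖F(Z₀)‖`. Hence
contraction by `τ` happens only finitely often, and the decrease condition forces `α_k² |⟨grad f,
ΔZ_k⟩| → 0`.

Since `σ̄_k` stays away from zero near `Z₀`, the inexact solutions are bounded and subconverge to an
exact solution `Y₀` of the limiting regularized equation (`exists_subseq_tendsto_direction`). By
`stationary_or_descent`, either `Z₀` is stationary or the limiting direction has slope `v < 0`. In
the second case `α_k → 0` along the subsequence, so the previous trial step `α_k / ρ` failed the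
decrease test. Dividing that failure by the step and passing to the limit gives `v ≥ 0`, because the
required decrease is quadratic in the step.

The last limit needs the retraction to be first-order accurate along moving base points
(`tendsto_retr_sub`). This rests on quantitative bounds for QR (`norm_sub_le_of_isQFactor`) and
Sinkhorn scaling (`IsSinkhorn.norm_sub_le`). They hold for every admissible factor or scaling, so
only existence, not uniqueness, has to be proved. -/

theorem frob_apply {n : ℕ} (A B : Mat n) : frob n A B = ∑ i, ∑ j, A i j * B i j := by
  rw [Finset.sum_comm]
  simp [frob, Matrix.trace, Matrix.mul_apply]

theorem frob_self_eq_norm_sq {n : ℕ} (A : Mat n) : frob n A A = ‖A‖ ^ 2 := by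
  rw [frob_apply, Matrix.frobenius_norm_def, ← Real.sqrt_eq_rpow, Real.sq_sqrt (by positivity)]
  simp [sq]

theorem frob_comm {n : ℕ} (A B : Mat n) : frob n A B = frob n B A := by
  simp [frob_apply, mul_comm]

/-- Cauchy–Schwarz: expand the square of `‖B‖ A - ‖A‖ B` and cancel `‖A‖ ‖B‖`. -/
theorem frob_le_norm_mul_norm {n : ℕ} (A B : Mat n) : frob n A B ≤ ‖A‖ * ‖B‖ := by
  have h := fun x : ℝ => frob_self_nonneg (‖B‖ • A - ‖A‖ • B)
  have h0 := h 0
  simp only [map_sub, map_smul, LinearMap.sub_apply, LinearMap.smul_apply, smul_eq_mul,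
    frob_self_eq_norm_sq, frob_comm B A] at h0
  rcases eq_or_ne A 0 with rfl | hA
  · simp
  rcases eq_or_ne B 0 with rfl | hB
  · simp
  have hp : 0 < ‖A‖ * ‖B‖ := mul_pos (norm_pos_iff.2 hA) (norm_pos_iff.2 hB)
  refine le_of_mul_le_mul_left ?_ hp
  nlinarith

theorem abs_entry_le_norm {n : ℕ} (A : Mat n) (i j : Fin n) : |A i j| ≤ ‖A‖ := by
  refine abs_le_of_sq_le_sq ?_ (norm_nonneg _)
  rw [← frob_self_eq_norm_sq, frob_apply, sq]
  exact (Finset.single_le_sum (f := fun j => A i j * A i j) (fun j _ => mul_self_nonneg _)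
    (Finset.mem_univ j)).trans (Finset.single_le_sum (f := fun i => ∑ j, A i j * A i j)
      (fun i _ => Finset.sum_nonneg fun j _ => mul_self_nonneg _) (Finset.mem_univ i))

theorem norm_le_of_abs_entry_le {n : ℕ} {A B : Mat n} (h : ∀ i j, |A i j| ≤ |B i j|) :
    ‖A‖ ≤ ‖B‖ := by
  refine le_of_sq_le_sq ?_ (norm_nonneg _)
  rw [← frob_self_eq_norm_sq, ← frob_self_eq_norm_sq, frob_apply, frob_apply]
  exact Finset.sum_le_sum fun i _ => Finset.sum_le_sum fun j _ => by
    simpa [sq] using sq_le_sq.2 (h i j)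

theorem norm_sq_of_mem_On {n : ℕ} {Q : Mat n} (hQ : Q ∈ On n) : ‖Q‖ ^ 2 = n := by
  have h : Qᵀ * Q = 1 := hQ
  rw [← frob_self_eq_norm_sq]
  simp [frob, h]

/-! ### The QR decomposition -/

open InnerProductSpace in
-- Gram–Schmidt on the columns. Each diagonal entry of the triangular factor is the length of an
-- unnormalized Gram–Schmidt vector, since a column differs from that vector only by earlier,
-- orthogonal ones.
theorem exists_isQFactor {n : ℕ} {A : Mat n} (hA : A.det ≠ 0) : ∃ Q, IsQFactor A Q := by
  let v : Fin n → EuclideanSpace ℝ (Fin n) := fun j => WithLp.toLp 2 (A.col j)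
  have hv : LinearIndependent ℝ v := by
    have h : LinearIndependent ℝ A.col :=
      Matrix.linearIndependent_cols_iff_isUnit.2 ((Matrix.isUnit_iff_isUnit_det A).2 hA.isUnit)
    exact h.map' (WithLp.linearEquiv 2 ℝ (Fin n → ℝ)).symm.toLinearMap (LinearEquiv.ker _)
  have hd : Module.finrank ℝ (EuclideanSpace ℝ (Fin n)) = Fintype.card (Fin n) := by simp
  let b := gramSchmidtOrthonormalBasis hd v
  have hb : ∀ i, b i = gramSchmidtNormed ℝ v i := fun i => by
    refine gramSchmidtOrthonormalBasis_apply hd ?_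
    have := gramSchmidtNormed_unit_length i hv
    exact fun h => by simp [h] at this
  refine ⟨Matrix.of fun i k => b k i, ?_, Matrix.of fun k j => inner ℝ (b k) (v j), ?_, ?_, ?_⟩
  · change _ = _
    ext i j
    have := orthonormal_iff_ite.1 b.orthonormal i j
    rw [Matrix.mul_apply, Matrix.one_apply, ← this]
    simp [PiLp.inner_apply, mul_comm]
  · intro i j hij
    exact gramSchmidtOrthonormalBasis_inv_triangular hd v hij
  · intro i
    have hne := gramSchmidt_ne_zero (𝕜 := ℝ) i hv
    have h1 : inner ℝ (gramSchmidt ℝ v i) (v i) = ‖gramSchmidt ℝ v i‖ ^ 2 := by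
      rw [← real_inner_self_eq_norm_sq]
      conv_lhs => rw [gramSchmidt_def'' ℝ v i]
      rw [inner_add_right, inner_sum, Finset.sum_eq_zero, add_zero]
      intro j hj
      rw [inner_smul_right, gramSchmidt_orthogonal ℝ v (Finset.mem_Iio.1 hj).ne', mul_zero]
    have h2 : inner ℝ (b i) (v i) = ‖gramSchmidt ℝ v i‖ := by
      rw [hb, gramSchmidtNormed, inner_smul_left, h1]
      have := norm_pos_iff.2 hne
      simp
      field_simp
    rw [Matrix.of_apply, h2]
    exact norm_pos_iff.2 hne
  · ext i j
    have := congrArg (fun x : EuclideanSpace ℝ (Fin n) => x i) (b.sum_repr' (v j))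
    simp only [Matrix.mul_apply, Matrix.of_apply]
    simpa [v, mul_comm] using this.symm

theorem abs_sub_one_le_abs_sub_inv {r : ℝ} (hr : 0 < r) : |r - 1| ≤ |r - r⁻¹| := by
  have : r - r⁻¹ = (r - 1) * (1 + r⁻¹) := by field_simp; ring
  rw [this, abs_mul]
  refine le_mul_of_one_le_right (abs_nonneg _) ?_
  rw [abs_of_pos (by positivity)]
  linarith [inv_pos.2 hr]

/-- An upper triangular matrix with positive diagonal is close to the identity if it is close to
being orthogonal. -/
theorem norm_sub_one_le_of_upperTriangular {n : ℕ} {R : Mat n} (hR : ∀ i j, j < i → R i j = 0)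
    (hd : ∀ i, 0 < R i i) (hE : ‖Rᵀ * R - 1‖ ≤ 1 / 2) :
    ‖R - 1‖ ≤ 2 * ‖R‖ * ‖Rᵀ * R - 1‖ := by
  have hT : R.IsUpperTriangular := fun i j h => hR i j h
  have hdet : IsUnit R.det := by
    rw [Matrix.det_of_isUpperTriangular hT]
    exact (Finset.prod_pos fun i _ => hd i).ne'.isUnit
  have hTi : ∀ i j, j < i → R⁻¹ i j = 0 := by
    let := R.invertibleOfIsUnitDet hdet
    have := Matrix.blockTriangular_inv_of_blockTriangular hT
    exact fun i j h => this h
  have hdi : ∀ i, R⁻¹ i i = (R i i)⁻¹ := fun i => by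
    have h := congrFun (congrFun (R.mul_nonsing_inv hdet) i) i
    rw [Matrix.mul_apply, Finset.sum_eq_single i, Matrix.one_apply_eq] at h
    · exact eq_inv_of_mul_eq_one_right h
    · intro j _ hj
      rcases lt_or_gt_of_ne hj with h | h
      · rw [hR i j h, zero_mul]
      · rw [hTi j i h, mul_zero]
    · simp
  set E := Rᵀ * R - 1 with hEdef
  set T := (R⁻¹)ᵀ with hTdef
  have hTR : T * Rᵀ = 1 := by
    rw [hTdef, ← Matrix.transpose_mul, R.mul_nonsing_inv hdet, Matrix.transpose_one]
  have hTE : T * E = R - T := by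
    rw [hEdef, mul_sub, ← mul_assoc, hTR, one_mul, mul_one]
  -- `T` is lower triangular, so `R - T` dominates `R - 1` entrywise: above the diagonal `T`
  -- vanishes, on it `|r - 1| ≤ |r - r⁻¹|`, and below it `R - 1` vanishes.
  have h1 : ‖R - 1‖ ≤ ‖T * E‖ := by
    refine norm_le_of_abs_entry_le fun i j => ?_
    rw [hTE, Matrix.sub_apply, Matrix.sub_apply, hTdef, Matrix.transpose_apply]
    rcases lt_trichotomy i j with h | h | h
    · rw [hTi j i h, Matrix.one_apply_ne h.ne]
    · subst h
      rw [hdi, Matrix.one_apply_eq]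
      exact abs_sub_one_le_abs_sub_inv (hd i)
    · rw [hR i j h, Matrix.one_apply_ne h.ne']
      simp
  -- Absorption: `‖T‖ ≤ ‖R‖ + ‖T‖ ‖E‖` with `‖E‖ ≤ 1/2`.
  have h2 : ‖T‖ ≤ 2 * ‖R‖ := by
    have h : ‖T‖ ≤ ‖R‖ + ‖T * E‖ := by
      have : T = R - T * E := by rw [hTE]; abel
      calc ‖T‖ = ‖R - T * E‖ := by rw [← this]
        _ ≤ _ := norm_sub_le _ _
    have h' := Matrix.frobenius_norm_mul T E
    nlinarith [norm_nonneg T]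
  exact h1.trans ((Matrix.frobenius_norm_mul T E).trans
    (mul_le_mul_of_nonneg_right h2 (norm_nonneg _)))

/-- With `A = U R`, the defect `AᵀA - 1` equals `RᵀR - 1`, and `U - A = U (1 - R)`; the factor `n`
is `‖U‖²`. -/
theorem norm_sub_le_of_isQFactor {n : ℕ} {A U : Mat n} (h : IsQFactor A U)
    (hE : ‖Aᵀ * A - 1‖ ≤ 1 / 2) : ‖U - A‖ ≤ 2 * n * ‖A‖ * ‖Aᵀ * A - 1‖ := by
  obtain ⟨hU, R, hR, hd, hAR⟩ := h
  have hU' : Uᵀ * U = 1 := hU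
  have hG : Rᵀ * R = Aᵀ * A := by
    rw [hAR, Matrix.transpose_mul, mul_assoc, ← mul_assoc Uᵀ, hU', one_mul]
  have hRA : R = Uᵀ * A := by rw [hAR, ← mul_assoc, hU', one_mul]
  have hn := norm_sq_of_mem_On hU
  have h1 := norm_sub_one_le_of_upperTriangular hR hd (by rw [hG]; exact hE)
  rw [hG] at h1
  have h2 : ‖R‖ ≤ ‖U‖ * ‖A‖ := by
    rw [hRA]
    exact (Matrix.frobenius_norm_mul _ _).trans_eq (by rw [Matrix.frobenius_norm_transpose])
  have h3 : ‖U - A‖ ≤ ‖U‖ * ‖R - 1‖ := by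
    rw [norm_sub_rev, show A - U = U * (R - 1) by rw [mul_sub, mul_one, ← hAR]]
    exact Matrix.frobenius_norm_mul _ _
  calc ‖U - A‖ ≤ ‖U‖ * ‖R - 1‖ := h3
    _ ≤ ‖U‖ * (2 * (‖U‖ * ‖A‖) * ‖Aᵀ * A - 1‖) := by gcongr; exact h1.trans (by gcongr)
    _ = 2 * ‖U‖ ^ 2 * ‖A‖ * ‖Aᵀ * A - 1‖ := by ring
    _ = _ := by rw [hn]

/-! ### Sinkhorn's theorem -/

/-- At a positive maximizer of `x ↦ ∑ log xⱼ - ∑ log (M x)ᵢ`, the scaled column sums are one. -/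
theorem exists_isSinkhorn {n : ℕ} {M : Mat n} (hM : ∀ i j, 0 < M i j) : ∃ P, IsSinkhorn M P := by
  rcases Nat.eq_zero_or_pos n with rfl | hn
  · exact ⟨0, ⟨fun i => i.elim0, fun i => i.elim0, fun i => i.elim0⟩, 0, 0, fun i => i.elim0,
      fun i => i.elim0, by ext i; exact i.elim0⟩
  have : Nonempty (Fin n) := ⟨⟨0, hn⟩⟩
  -- The exponential of the objective, which also makes sense on the boundary of the simplex. It is
  -- homogeneous of degree zero, so a maximizer on the compact simplex is maximal over the positive
  -- orthant; its value there is positive, which keeps it off the boundary.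
  let φ : (Fin n → ℝ) → ℝ := fun x => (∏ j, x j) / ∏ i, (M *ᵥ x) i
  have hMx : ∀ x : Fin n → ℝ, (∀ j, 0 ≤ x j) → (∃ j, 0 < x j) → ∀ i, 0 < (M *ᵥ x) i := by
    rintro x hx ⟨j, hj⟩ i
    exact Finset.sum_pos' (fun k _ => mul_nonneg (hM i k).le (hx k))
      ⟨j, Finset.mem_univ _, mul_pos (hM i j) hj⟩
  have hsimp : ∀ x ∈ stdSimplex ℝ (Fin n), ∃ j, 0 < x j := by
    rintro x ⟨hx, hs⟩
    by_contra! h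
    have := Finset.sum_nonpos fun j (_ : j ∈ Finset.univ) => h j
    linarith
  have hcont : ContinuousOn φ (stdSimplex ℝ (Fin n)) := by
    refine ContinuousOn.div (by fun_prop) ?_ ?_
    · refine Continuous.continuousOn ?_
      refine continuous_finsetProd _ fun i _ => ?_
      exact (continuous_apply i).comp (Continuous.matrix_mulVec continuous_const continuous_id)
    · intro x hx
      exact (Finset.prod_pos fun i _ => hMx x hx.1 (hsimp x hx) i).ne'
  have hne : (stdSimplex ℝ (Fin n)).Nonempty := ⟨_, (stdSimplex.barycenter (X := Fin n) (𝕜 := ℝ)).2⟩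
  obtain ⟨x, hx, hmax⟩ := (isCompact_stdSimplex ℝ (Fin n)).exists_isMaxOn hne hcont
  have hhom : ∀ (c : ℝ) (y : Fin n → ℝ), c ≠ 0 → φ (c • y) = φ y := by
    intro c y hc
    simp only [φ, Matrix.mulVec_smul, Pi.smul_apply, smul_eq_mul, Finset.prod_mul_distrib,
      Finset.prod_const]
    rw [mul_div_mul_left _ _ (pow_ne_zero _ hc)]
  have hmax' : ∀ y : Fin n → ℝ, (∀ j, 0 < y j) → φ y ≤ φ x := by
    intro y hy
    have hs : 0 < ∑ j, y j := Finset.sum_pos (fun j _ => hy j) Finset.univ_nonempty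
    rw [← hhom (∑ j, y j)⁻¹ y (inv_ne_zero hs.ne')]
    refine hmax ⟨fun j => ?_, ?_⟩
    · exact mul_nonneg (inv_pos.2 hs).le (hy j).le
    · simp only [Pi.smul_apply, smul_eq_mul, ← Finset.mul_sum]
      exact inv_mul_cancel₀ hs.ne'
  have hxpos : ∀ j, 0 < x j := by
    have h1 : 0 < φ 1 := div_pos (by simp)
      (Finset.prod_pos fun i _ => hMx 1 (fun _ => zero_le_one) ⟨⟨0, hn⟩, one_pos⟩ i)
    have h2 := h1.trans_le (hmax' 1 fun _ => one_pos)
    intro j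
    refine (hx.1 j).lt_of_ne' fun h0 => ?_
    have : φ x = 0 := by simp [φ, Finset.prod_eq_zero (Finset.mem_univ j) h0]
    linarith
  have hpos := hMx x hx.1 (hsimp x hx)
  -- Taking `r = 1 / (M x)` makes the row sums one by construction; only the column sums use
  -- maximality, via the derivative in the `j`-th coordinate.
  refine ⟨_, ⟨?_, ?_, ?_⟩, fun i => ((M *ᵥ x) i)⁻¹, x, fun i => inv_pos.2 (hpos i), hxpos, rfl⟩
  · intro i j
    simp only [Matrix.mul_diagonal, Matrix.diagonal_mul]
    have := hpos i; have := hM i j; have := hxpos j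
    positivity
  · intro i
    simp only [Matrix.mul_diagonal, Matrix.diagonal_mul, mul_assoc, ← Finset.mul_sum]
    exact inv_mul_cancel₀ (hpos i).ne'
  · intro j
    simp only [Matrix.mul_diagonal, Matrix.diagonal_mul]
    let y : ℝ → Fin n → ℝ := fun s => x + s • Pi.single j 1
    let g : ℝ → ℝ := fun s => ∑ k, Real.log (y s k) - ∑ i, Real.log ((M *ᵥ y s) i)
    have hy0 : y 0 = x := by simp [y]
    have hyj : ∀ k, HasDerivAt (fun s => y s k) (if k = j then 1 else 0) 0 := by
      intro k
      have := ((hasDerivAt_id (0 : ℝ)).mul_const ((Pi.single j 1 : Fin n → ℝ) k)).const_add (x k)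
      simpa [y, Pi.single_apply] using this
    have hMy : ∀ i, HasDerivAt (fun s => (M *ᵥ y s) i) (M i j) 0 := by
      intro i
      have := HasDerivAt.fun_sum (u := Finset.univ) fun k _ => (hyj k).const_mul (M i k)
      simpa [Matrix.mulVec, dotProduct] using this
    have hg : HasDerivAt g (∑ k, (if k = j then 1 else 0) / x k
        - ∑ i, M i j / (M *ᵥ x) i) 0 := by
      refine HasDerivAt.sub (HasDerivAt.fun_sum fun k _ => ?_) (HasDerivAt.fun_sum fun i _ => ?_)
      · have := (hyj k).log (by rw [hy0]; exact (hxpos k).ne')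
        rwa [hy0] at this
      · have := (hMy i).log (by rw [hy0]; exact (hpos i).ne')
        rwa [hy0] at this
    have hev : ∀ᶠ s in 𝓝 (0 : ℝ), ∀ k, 0 < y s k := by
      rw [eventually_all]
      intro k
      have := (hyj k).continuousAt.tendsto
      rw [hy0] at this
      exact this.eventually (lt_mem_nhds (hxpos k))
    have hlog : ∀ z : Fin n → ℝ, (∀ k, 0 < z k) →
        ∑ k, Real.log (z k) - ∑ i, Real.log ((M *ᵥ z) i) = Real.log (φ z) := by
      intro z hz
      have hz' := hMx z (fun k => (hz k).le) ⟨j, hz j⟩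
      rw [Real.log_div (Finset.prod_pos fun k _ => hz k).ne'
        (Finset.prod_pos fun k _ => hz' k).ne', Real.log_prod fun k _ => (hz k).ne',
        Real.log_prod fun k _ => (hz' k).ne']
    have hloc : IsLocalMax g 0 := by
      filter_upwards [hev] with s hs
      have h0 : g 0 = Real.log (φ x) := by rw [← hlog x hxpos]; simp only [g, hy0]
      rw [h0, show g s = _ from hlog _ hs]
      refine Real.log_le_log ?_ (hmax' _ hs)
      exact div_pos (Finset.prod_pos fun k _ => hs k)
        (Finset.prod_pos fun i _ => hMx _ (fun k => (hs k).le) ⟨j, hs j⟩ i)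
    have h0 := hloc.hasDerivAt_eq_zero hg
    simp only [ite_div, zero_div, Finset.sum_ite_eq', Finset.mem_univ, if_true] at h0
    have h1 : ∑ i, M i j / (M *ᵥ x) i = 1 / x j := by linarith
    rw [← Finset.sum_mul]
    calc (∑ i, ((M *ᵥ x) i)⁻¹ * M i j) * x j = (∑ i, M i j / (M *ᵥ x) i) * x j := by
          congr 1; exact Finset.sum_congr rfl fun i _ => by rw [div_eq_inv_mul]
      _ = 1 := by rw [h1]; exact one_div_mul_cancel (hxpos j).ne'

/-! ### Distance between a positive matrix and its Sinkhorn scaling. -/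

theorem abs_log_sub_log_le {a b m : ℝ} (hm : 0 < m) (ha : m ≤ a) (hb : m ≤ b) :
    |Real.log a - Real.log b| ≤ |a - b| / m := by
  wlog h : b ≤ a generalizing a b
  · rw [abs_sub_comm, abs_sub_comm a]
    exact this hb ha (le_of_not_ge h)
  have hb0 := hm.trans_le hb
  have ha0 := hm.trans_le ha
  rw [abs_of_nonneg (sub_nonneg.2 (Real.log_le_log hb0 h)), abs_of_nonneg (sub_nonneg.2 h),
    ← Real.log_div ha0.ne' hb0.ne']
  calc Real.log (a / b) ≤ a / b - 1 := Real.log_le_sub_one_of_pos (div_pos ha0 hb0)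
    _ = (a - b) / b := by field_simp
    _ ≤ (a - b) / m := div_le_div_of_nonneg_left (sub_nonneg.2 h) hm hb

/-- Strong monotonicity: the logarithm has slope at least `1 / B` on `(0, B]`. -/
theorem sq_sub_le_mul_log_sub_log {a b B : ℝ} (ha : 0 < a) (hb : 0 < b) (haB : a ≤ B)
    (hbB : b ≤ B) : (a - b) ^ 2 ≤ B * ((a - b) * (Real.log a - Real.log b)) := by
  wlog h : b ≤ a generalizing a b
  · have := this hb ha hbB haB (le_of_not_ge h)
    nlinarith
  have h1 : (a - b) / a ≤ Real.log a - Real.log b := by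
    rw [← Real.log_div ha.ne' hb.ne']
    have := Real.one_sub_inv_le_log_of_pos (div_pos ha hb)
    rwa [inv_div, one_sub_div ha.ne'] at this
  have hB : 0 < B := ha.trans_le haB
  have h2 : (a - b) / B ≤ Real.log a - Real.log b :=
    (div_le_div_of_nonneg_left (sub_nonneg.2 h) ha haB).trans h1
  rw [div_le_iff₀ hB] at h2
  nlinarith

/-- The entries of the Sinkhorn scaling are bounded below. -/
theorem IsSinkhorn.lower_bound {n : ℕ} {M P : Mat n} (h : IsSinkhorn M P) {m : ℝ} (hm : 0 < m)
    (hmM : ∀ i j, m ≤ M i j) (hM2 : ∀ i j, M i j ≤ 2) (i j : Fin n) : m ^ 2 / (4 * n) ≤ P i j := by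
  obtain ⟨⟨hP, hr1, hc1⟩, r, c, hr, hc, rfl⟩ := h
  simp only [Matrix.mul_diagonal, Matrix.diagonal_mul] at *
  have hn : (0 : ℝ) < n := by
    have := i.pos
    exact_mod_cast this
  -- The pair `(r, c)` is determined only up to a scalar, so the bounds are expressed through `s`,
  -- which cancels in the product `r i * M i j * c j`. The column sums bound `c` on both sides, and
  -- a row sum then bounds `r i` below.
  set s := ∑ k, r k with hs
  have hspos : 0 < s := Finset.sum_pos (fun k _ => hr k) ⟨i, Finset.mem_univ _⟩
  have hclow : ∀ l, 1 ≤ 2 * s * c l := by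
    intro l
    rw [← hc1 l, ← Finset.sum_mul, hs, Finset.mul_sum]
    refine mul_le_mul_of_nonneg_right (Finset.sum_le_sum fun k _ => ?_) (hc l).le
    rw [mul_comm]
    exact mul_le_mul_of_nonneg_right (hM2 k l) (hr k).le
  have hcup : ∀ l, m * s * c l ≤ 1 := by
    intro l
    rw [← hc1 l, ← Finset.sum_mul, hs, Finset.mul_sum]
    refine mul_le_mul_of_nonneg_right (Finset.sum_le_sum fun k _ => ?_) (hc l).le
    rw [mul_comm]
    exact mul_le_mul_of_nonneg_left (hmM k l) (hr k).le
  have hri : 1 ≤ r i * (2 * (n / (m * s))) := by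
    rw [← hr1 i]
    simp only [mul_assoc, ← Finset.mul_sum]
    refine mul_le_mul_of_nonneg_left ?_ (hr i).le
    calc ∑ l, M i l * c l ≤ ∑ _l : Fin n, 2 * (1 / (m * s)) := by
          refine Finset.sum_le_sum fun l _ => mul_le_mul (hM2 i l) ?_ (hc l).le zero_le_two
          rw [le_div_iff₀ (by positivity)]
          linarith [hcup l]
      _ = _ := by simp; ring
  have hri' : m * s / (2 * n) ≤ r i := by
    rw [div_le_iff₀ (by positivity)]
    have : r i * (2 * (n / (m * s))) = r i * (2 * n) / (m * s) := by ring
    rw [this, le_div_iff₀ (by positivity)] at hri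
    linarith
  have hcj : 1 / (2 * s) ≤ c j := by
    rw [div_le_iff₀ (by positivity)]
    linarith [hclow j]
  calc m ^ 2 / (4 * n) = m * s / (2 * n) * m * (1 / (2 * s)) := by field_simp; norm_num
    _ ≤ r i * M i j * c j := by
      have h1 := hmM i j
      have h2 := hr i
      exact mul_le_mul (mul_le_mul hri' h1 hm.le h2.le) hcj (by positivity)
        (mul_nonneg h2.le (hm.le.trans h1))

/-- The Sinkhorn scaling of a matrix is close to it if its row and column sums are close to one. -/
theorem IsSinkhorn.norm_sub_le {n : ℕ} {M P : Mat n} (h : IsSinkhorn M P) {m e : ℝ} (hm : 0 < m)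
    (hm1 : m ≤ 1)
    (hmM : ∀ i j, m ≤ M i j) (hM2 : ∀ i j, M i j ≤ 2) (hrow : ∀ i, |∑ j, M i j - 1| ≤ e)
    (hcol : ∀ j, |∑ i, M i j - 1| ≤ e) :
    ‖P - M‖ ≤ 24 * n ^ 2 / m ^ 2 * e := by
  rcases Nat.eq_zero_or_pos n with rfl | hn
  · have : P - M = 0 := by ext i; exact i.elim0
    simp [this]
  have hn' : (1 : ℝ) ≤ n := by exact_mod_cast hn
  have hlow := h.lower_bound hm hmM hM2
  obtain ⟨⟨hP, hr1, hc1⟩, r, c, hr, hc, hPM⟩ := h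
  have he : 0 ≤ e := (abs_nonneg _).trans (hrow ⟨0, hn⟩)
  set D := ‖P - M‖ with hD
  set q := m ^ 2 / (4 * n) with hq
  have hqpos : 0 < q := by positivity
  have hqm : q ≤ m := by
    rw [hq, div_le_iff₀ (by positivity)]
    nlinarith
  have hMpos : ∀ i j, 0 < M i j := fun i j => hm.trans_le (hmM i j)
  let i0 : Fin n := ⟨0, hn⟩
  -- The logarithmic change is a function of `i` plus a function of `j`, so its pairing with `P - M`
  -- sees only the defects of the row and column sums, while strong monotonicity bounds the same
  -- pairing below by `D² / 2`.
  let u : Fin n → Fin n → ℝ := fun i j => Real.log (P i j) - Real.log (M i j)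
  have hu : ∀ i j, u i j = Real.log (r i) + Real.log (c j) := by
    intro i j
    simp only [u, hPM, Matrix.mul_diagonal, Matrix.diagonal_mul]
    rw [Real.log_mul (mul_pos (hr i) (hMpos i j)).ne' (hc j).ne',
      Real.log_mul (hr i).ne' (hMpos i j).ne']
    ring
  have hub : ∀ i j, |u i j| ≤ D / q := fun i j =>
    (abs_log_sub_log_le hqpos (hlow i j) (hqm.trans (hmM i j))).trans
      (div_le_div_of_nonneg_right (abs_entry_le_norm (P - M) i j) hqpos.le)
  have hP1 : ∀ i j, P i j ≤ 1 := fun i j => by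
    rw [← hr1 i]
    exact Finset.single_le_sum (f := fun j => P i j) (fun j _ => (hP i j).le) (Finset.mem_univ j)
  have h1 : D ^ 2 ≤ 2 * ∑ i, ∑ j, (P i j - M i j) * u i j := by
    rw [hD, ← frob_self_eq_norm_sq, frob_apply, Finset.mul_sum]
    refine Finset.sum_le_sum fun i _ => ?_
    rw [Finset.mul_sum]
    refine Finset.sum_le_sum fun j _ => ?_
    rw [← sq]
    exact sq_sub_le_mul_log_sub_log (hP i j) (hMpos i j) ((hP1 i j).trans one_le_two) (hM2 i j)
  -- The splitting is normalized at index `i0`, so both parts are expressed by values of `u`, which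
  -- are bounded, unlike `log r` and `log c` separately.
  have h2 : ∑ i, ∑ j, (P i j - M i j) * u i j =
      ∑ i, (u i i0 - u i0 i0) * (1 - ∑ j, M i j) + ∑ j, u i0 j * (1 - ∑ i, M i j) := by
    have e1 : ∀ i j, (P i j - M i j) * u i j =
        (u i i0 - u i0 i0) * (P i j - M i j) + u i0 j * (P i j - M i j) := by
      intro i j
      rw [hu i j, hu i i0, hu i0 i0, hu i0 j]
      ring
    simp only [e1, Finset.sum_add_distrib]
    congr 1
    · refine Finset.sum_congr rfl fun i _ => ?_
      rw [← Finset.mul_sum, Finset.sum_sub_distrib, hr1]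
    · rw [Finset.sum_comm]
      refine Finset.sum_congr rfl fun j _ => ?_
      rw [← Finset.mul_sum, Finset.sum_sub_distrib, hc1]
  have h3 : ∑ i, (u i i0 - u i0 i0) * (1 - ∑ j, M i j) ≤ n * (2 * (D / q) * e) := by
    calc _ ≤ ∑ _i : Fin n, 2 * (D / q) * e := by
          refine Finset.sum_le_sum fun i _ => (le_abs_self _).trans ?_
          rw [abs_mul, abs_sub_comm 1]
          refine mul_le_mul ?_ (hrow i) (abs_nonneg _) (by positivity)
          have := abs_sub (u i i0) (u i0 i0)
          linarith [hub i i0, hub i0 i0]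
      _ = _ := by simp
  have h4 : ∑ j, u i0 j * (1 - ∑ i, M i j) ≤ n * (D / q * e) := by
    calc _ ≤ ∑ _j : Fin n, D / q * e := by
          refine Finset.sum_le_sum fun j _ => (le_abs_self _).trans ?_
          rw [abs_mul, abs_sub_comm 1]
          exact mul_le_mul (hub i0 j) (hcol j) (abs_nonneg _) (by positivity)
      _ = _ := by simp
  -- The bound on `u` is itself linear in `D`, so one factor `D` cancels and the estimate becomes
  -- linear in `e`.
  have h5 : D * D ≤ D * (24 * n ^ 2 / m ^ 2 * e) := by
    calc D * D = D ^ 2 := (sq D).symm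
      _ ≤ 2 * (n * (2 * (D / q) * e) + n * (D / q * e)) := by linarith
      _ = D * (24 * n ^ 2 / m ^ 2 * e) := by rw [hq]; field_simp; ring
  rcases (norm_nonneg (P - M)).eq_or_lt with h0 | h0
  · rw [hD, ← h0]; positivity
  · exact le_of_mul_le_mul_left h5 h0

/-! ### First order behaviour of the retraction -/

theorem tendsto_mat_iff {n : ℕ} {ι : Type*} {l : Filter ι} {A : ι → Mat n} {B : Mat n} :
    Tendsto A l (𝓝 B) ↔ ∀ i j, Tendsto (fun k => A k i j) l (𝓝 (B i j)) := by
  refine ⟨fun h i j => ((continuous_id.matrix_elem i j).tendsto B).comp h, fun h => ?_⟩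
  exact tendsto_pi_nhds.2 fun i => tendsto_pi_nhds.2 (h i)

/-- Second-order Taylor bound: `a exp(t x / a) - a` differs from `t x` by at most `t² x² / a` once
`|t x / a| ≤ 1`. -/
theorem tendsto_mul_exp_sub {ι : Type*} {l : Filter ι} {t a x : ι → ℝ} {a₀ x₀ : ℝ}
    (ht : Tendsto t l (𝓝 0)) (htpos : ∀ᶠ k in l, 0 < t k) (ha : Tendsto a l (𝓝 a₀)) (ha₀ : 0 < a₀)
    (hx : Tendsto x l (𝓝 x₀)) :
    Tendsto (fun k => (t k)⁻¹ * (a k * Real.exp (t k * x k / a k) - a k)) l (𝓝 x₀) := by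
  have hy : Tendsto (fun k => t k * x k / a k) l (𝓝 0) := by
    have h := (ht.mul hx).div ha ha₀.ne'
    rwa [zero_mul, zero_div] at h
  have hb : Tendsto (fun k => t k * (x k ^ 2 / a k)) l (𝓝 0) := by
    simpa using ht.mul ((hx.pow 2).div ha ha₀.ne')
  have hsub : Tendsto (fun k => (t k)⁻¹ * (a k * Real.exp (t k * x k / a k) - a k) - x k) l
      (𝓝 0) := by
    refine squeeze_zero_norm' ?_ hb
    have hy1 := (tendsto_order.1 hy.abs).2 1 (by simp)
    filter_upwards [htpos, ha.eventually (lt_mem_nhds ha₀), hy1] with k hk hak hyk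
    have h := Real.abs_exp_sub_one_sub_id_le hyk.le
    have e : (t k)⁻¹ * (a k * Real.exp (t k * x k / a k) - a k) - x k =
        (t k)⁻¹ * a k * (Real.exp (t k * x k / a k) - 1 - t k * x k / a k) := by
      field_simp
    rw [e, Real.norm_eq_abs, abs_mul, abs_of_pos (by positivity : 0 < (t k)⁻¹ * a k)]
    calc _ ≤ (t k)⁻¹ * a k * (t k * x k / a k) ^ 2 := by gcongr
      _ = _ := by field_simp
  simpa using hsub.add hx

theorem sinkhorn_spec {n : ℕ} {M : Mat n} (hM : ∀ i j, 0 < M i j) : IsSinkhorn M (sinkhorn M) :=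
  Classical.epsilon_spec (exists_isSinkhorn hM)

theorem qf_spec {n : ℕ} {A : Mat n} (hA : A.det ≠ 0) : IsQFactor A (qf A) :=
  Classical.epsilon_spec (exists_isQFactor hA)

section

variable {n : ℕ} {ι : Type*} {l : Filter ι} {t : ι → ℝ}

/-- Before scaling, the matrix is `C + t X + o(t)`. Because `X` has zero row and column sums, its
sums miss one only by `o(t)`, and the Sinkhorn correction is then also `o(t)`. -/
theorem tendsto_retrDP_sub (ht : Tendsto t l (𝓝 0)) (htpos : ∀ᶠ k in l, 0 < t k)
    {C X : ι → Mat n} {C₀ X₀ : Mat n} (hC : ∀ k, C k ∈ DP n) (hC₀ : C₀ ∈ DP n)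
    (hCt : Tendsto C l (𝓝 C₀)) (hX : ∀ k, X k ∈ tanDP n) (hXt : Tendsto X l (𝓝 X₀)) :
    Tendsto (fun k => (t k)⁻¹ • (retrDP (C k) (t k • X k) - C k)) l (𝓝 X₀) := by
  let M : ι → Mat n := fun k => Matrix.of fun i j => C k i j * Real.exp ((t k • X k) i j / C k i j)
  have hM1 : Tendsto (fun k => (t k)⁻¹ • (M k - C k)) l (𝓝 X₀) := by
    refine tendsto_mat_iff.2 fun i j => ?_
    exact tendsto_mul_exp_sub ht htpos (tendsto_mat_iff.1 hCt i j) (hC₀.1 i j)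
      (tendsto_mat_iff.1 hXt i j)
  have hMC : Tendsto M l (𝓝 C₀) := by
    have h : Tendsto (fun k => t k • ((t k)⁻¹ • (M k - C k)) + C k) l (𝓝 C₀) := by
      simpa using (ht.smul hM1).add hCt
    refine h.congr' ?_
    filter_upwards [htpos] with k hk
    rw [smul_inv_smul₀ hk.ne', sub_add_cancel]
  have hMpos : ∀ k i j, 0 < M k i j := fun k i j => mul_pos ((hC k).1 i j) (Real.exp_pos _)
  obtain ⟨m, hm, hm1, hmC⟩ : ∃ m : ℝ, 0 < m ∧ m ≤ 1 ∧ ∀ i j, m < C₀ i j := by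
    have h : ∀ᶠ m in 𝓝[>] (0 : ℝ), 0 < m ∧ m ≤ 1 ∧ ∀ i j, m < C₀ i j := by
      refine eventually_mem_nhdsWithin.and (Filter.Eventually.filter_mono nhdsWithin_le_nhds ?_)
      refine (eventually_le_nhds one_pos).and ?_
      exact eventually_all.2 fun i => eventually_all.2 fun j => eventually_lt_nhds (hC₀.1 i j)
    exact h.exists
  have hC1 : ∀ i j, C₀ i j < 2 := fun i j => by
    have : C₀ i j ≤ 1 := by
      rw [← hC₀.2.1 i]
      exact Finset.single_le_sum (f := fun j => C₀ i j) (fun j _ => (hC₀.1 i j).le)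
        (Finset.mem_univ j)
    linarith
  have hev1 : ∀ᶠ k in l, ∀ i j, m ≤ M k i j := eventually_all.2 fun i => eventually_all.2 fun j =>
    ((tendsto_mat_iff.1 hMC i j).eventually (lt_mem_nhds (hmC i j))).mono fun _ h => h.le
  have hev2 : ∀ᶠ k in l, ∀ i j, M k i j ≤ 2 := eventually_all.2 fun i => eventually_all.2 fun j =>
    ((tendsto_mat_iff.1 hMC i j).eventually (gt_mem_nhds (hC1 i j))).mono fun _ h => h.le
  -- The remainder divided by `t`; the sum defects of `M k` are exactly `t k` times the sums of `N
  -- k`.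
  let N : ι → Mat n := fun k => (t k)⁻¹ • (M k - C k) - X k
  have hN : Tendsto (fun k => ‖N k‖) l (𝓝 0) := by
    simpa using (hM1.sub hXt).norm
  have hrow : ∀ᶠ k in l, ∀ i, |∑ j, M k i j - 1| ≤ t k * (n * ‖N k‖) := by
    filter_upwards [htpos] with k hk i
    have e : ∑ j, M k i j - 1 = t k * ∑ j, N k i j := by
      simp only [N, Matrix.sub_apply, Matrix.smul_apply, smul_eq_mul, Finset.sum_sub_distrib,
        ← Finset.mul_sum, (hC k).2.1 i, (hX k).1 i, sub_zero]
      rw [mul_inv_cancel_left₀ hk.ne']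
    rw [e, abs_mul, abs_of_pos hk]
    refine mul_le_mul_of_nonneg_left ((Finset.abs_sum_le_sum_abs _ _).trans ?_) hk.le
    exact (Finset.sum_le_sum fun j _ => abs_entry_le_norm (N k) i j).trans_eq (by simp)
  have hcol : ∀ᶠ k in l, ∀ j, |∑ i, M k i j - 1| ≤ t k * (n * ‖N k‖) := by
    filter_upwards [htpos] with k hk j
    have e : ∑ i, M k i j - 1 = t k * ∑ i, N k i j := by
      simp only [N, Matrix.sub_apply, Matrix.smul_apply, smul_eq_mul, Finset.sum_sub_distrib,
        ← Finset.mul_sum, (hC k).2.2 j, (hX k).2 j, sub_zero]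
      rw [mul_inv_cancel_left₀ hk.ne']
    rw [e, abs_mul, abs_of_pos hk]
    refine mul_le_mul_of_nonneg_left ((Finset.abs_sum_le_sum_abs _ _).trans ?_) hk.le
    exact (Finset.sum_le_sum fun i _ => abs_entry_le_norm (N k) i j).trans_eq (by simp)
  have hPM : Tendsto (fun k => (t k)⁻¹ • (sinkhorn (M k) - M k)) l (𝓝 0) := by
    have hb : Tendsto (fun k => 24 * n ^ 2 / m ^ 2 * (n * ‖N k‖)) l (𝓝 0) := by
      simpa using (hN.const_mul (n : ℝ)).const_mul (24 * n ^ 2 / m ^ 2 : ℝ)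
    refine squeeze_zero_norm' ?_ hb
    filter_upwards [htpos, hev1, hev2, hrow, hcol] with k hk h1 h2 h3 h4
    have h := (sinkhorn_spec (hMpos k)).norm_sub_le hm hm1 h1 h2 h3 h4
    rw [norm_smul, norm_inv, Real.norm_of_nonneg hk.le, inv_mul_le_iff₀ hk]
    exact h.trans_eq (by ring)
  have := hPM.add hM1
  rw [zero_add] at this
  refine this.congr fun k => ?_
  rw [← smul_add, sub_add_sub_cancel]
  rfl

/-- For `X = Q K` with `K` skew, the cross terms cancel and `(Q + tX)ᵀ(Q + tX) = 1 + t² XᵀX`, so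
passing to the orthogonal factor changes `Q + tX` only by `O(t²)`. -/
theorem tendsto_retrOn_sub (ht : Tendsto t l (𝓝 0)) (htpos : ∀ᶠ k in l, 0 < t k)
    {Q X : ι → Mat n} {Q₀ X₀ : Mat n} (hQ : ∀ k, Q k ∈ On n) (hQ₀ : Q₀ ∈ On n)
    (hQt : Tendsto Q l (𝓝 Q₀)) (hX : ∀ k, X k ∈ tanOn (Q k)) (hXt : Tendsto X l (𝓝 X₀)) :
    Tendsto (fun k => (t k)⁻¹ • (retrOn (Q k) (t k • X k) - Q k)) l (𝓝 X₀) := by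
  let A : ι → Mat n := fun k => Q k + t k • X k
  have hA : Tendsto A l (𝓝 Q₀) := by simpa using hQt.add (ht.smul hXt)
  have hG : ∀ k, (A k)ᵀ * A k - 1 = t k ^ 2 • ((X k)ᵀ * X k) := by
    intro k
    obtain ⟨K, hK, hXK⟩ := hX k
    have hQk : (Q k)ᵀ * Q k = 1 := hQ k
    have h1 : (Q k)ᵀ * X k = K := by rw [hXK, ← mul_assoc, hQk, one_mul]
    have h2 : (X k)ᵀ * Q k = -K := by
      rw [hXK, Matrix.transpose_mul, mul_assoc, hQk, mul_one, hK]
    simp only [A, Matrix.transpose_add, Matrix.transpose_smul, add_mul, mul_add, Matrix.smul_mul,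
      Matrix.mul_smul, h1, h2, hQk, smul_smul, smul_neg, sq]
    abel
  have hX2 : Tendsto (fun k => ‖(X k)ᵀ * X k‖) l (𝓝 ‖X₀ᵀ * X₀‖) :=
    (((continuous_id.matrix_transpose.tendsto X₀).comp hXt).mul hXt).norm
  have hE : Tendsto (fun k => ‖(A k)ᵀ * A k - 1‖) l (𝓝 0) := by
    simp only [hG, norm_smul]
    simpa using (ht.pow 2).norm.mul hX2
  have hdet : ∀ᶠ k in l, (A k).det ≠ 0 := by
    have h0 : Q₀.det ≠ 0 := by
      have h : Q₀ᵀ * Q₀ = 1 := hQ₀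
      have := congrArg Matrix.det h
      rw [Matrix.det_mul, Matrix.det_one] at this
      exact right_ne_zero_of_mul (this.trans_ne one_ne_zero)
    exact ((continuous_id.matrix_det.tendsto Q₀).comp hA).eventually_ne h0
  have hUA : Tendsto (fun k => (t k)⁻¹ • (qf (A k) - A k)) l (𝓝 0) := by
    have hb : Tendsto (fun k => 2 * n * ‖A k‖ * (t k * ‖(X k)ᵀ * X k‖)) l (𝓝 0) := by
      simpa using (hA.norm.const_mul (2 * n : ℝ)).mul (ht.mul hX2)
    refine squeeze_zero_norm' ?_ hb
    filter_upwards [htpos, hdet, (tendsto_order.1 hE).2 (1 / 2) (by norm_num)] with k hk h1 h2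
    have h := norm_sub_le_of_isQFactor (qf_spec h1) h2.le
    rw [hG, norm_smul, norm_pow, Real.norm_of_nonneg hk.le] at h
    rw [norm_smul, norm_inv, Real.norm_of_nonneg hk.le, inv_mul_le_iff₀ hk]
    exact h.trans_eq (by ring)
  have := hUA.add hXt
  rw [zero_add] at this
  refine this.congr' ?_
  filter_upwards [htpos] with k hk
  have e : X k = (t k)⁻¹ • (A k - Q k) := by
    simp only [A, add_sub_cancel_left, inv_smul_smul₀ hk.ne']
  conv_lhs => rw [e]
  rw [← smul_add, sub_add_sub_cancel]
  rfl

theorem tendsto_retrW_sub (S : Spectrum n) (ht : Tendsto t l (𝓝 0)) (htpos : ∀ᶠ k in l, 0 < t k)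
    {W X : ι → Mat n} {W₀ X₀ : Mat n} (hW : ∀ k, W k ∈ calW S) (hW₀ : W₀ ∈ calW S)
    (hWt : Tendsto W l (𝓝 W₀)) (hX : ∀ k, X k ∈ tanW S) (hXt : Tendsto X l (𝓝 X₀)) :
    Tendsto (fun k => (t k)⁻¹ • (retrW S (W k) (t k • X k) - W k)) l (𝓝 X₀) := by
  refine tendsto_mat_iff.2 fun i j => ?_
  have hWij := tendsto_mat_iff.1 hWt i j
  have hXij := tendsto_mat_iff.1 hXt i j
  by_cases h : I2 S i j
  · simpa [retrW, h] using tendsto_mul_exp_sub ht htpos hWij (hW₀.2 i j h) hXij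
  · refine hXij.congr fun k => ?_
    simp [retrW, h, (hW k).1 i j h, hX k i j h]

/-- The base points and directions vary with the index, as they do in the line search; a derivative
of the retraction at one fixed point would not suffice. -/
theorem tendsto_retr_sub (S : Spectrum n) (ht : Tendsto t l (𝓝 0)) (htpos : ∀ᶠ k in l, 0 < t k)
    {Z : ι → ZMan S} {Z₀ : ZMan S} (hZ : Tendsto Z l (𝓝 Z₀)) {ξ : ∀ k, Tan S (Z k)} {ξ₀ : Amb n}
    (hξ : Tendsto (fun k => (ξ k).1) l (𝓝 ξ₀)) :
    Tendsto (fun k => (t k)⁻¹ • (retr S (Z k) (t k • ξ k) - (Z k).1)) l (𝓝 ξ₀) := by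
  have hZ' : Tendsto (fun k => (Z k).1) l (𝓝 Z₀.1) := (continuous_subtype_val.tendsto _).comp hZ
  have z1 := hZ'.fst_nhds
  have z2 := hZ'.snd_nhds.fst_nhds
  have z3 := hZ'.snd_nhds.snd_nhds.fst_nhds
  have x1 := hξ.fst_nhds
  have x2 := hξ.snd_nhds.fst_nhds
  have x3 := hξ.snd_nhds.snd_nhds.fst_nhds
  have x4 := hξ.snd_nhds.snd_nhds.snd_nhds
  refine (tendsto_retrDP_sub ht htpos (fun k => (Z k).2.1) Z₀.2.1 z1 (fun k => (ξ k).2.1)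
    x1).prodMk_nhds ((tendsto_retrOn_sub ht htpos (fun k => (Z k).2.2.1) Z₀.2.2.1 z2
    (fun k => (ξ k).2.2.1) x2).prodMk_nhds ((tendsto_retrW_sub S ht htpos (fun k => (Z k).2.2.2.1)
    Z₀.2.2.2.1 z3 (fun k => (ξ k).2.2.2.1) x3).prodMk_nhds (x4.congr' ?_)))
  filter_upwards [htpos] with k hk
  simp [retr, inv_smul_smul₀ hk.ne']

end

/-! ### Smoothness of the objective -/

theorem contDiffAt_entry {n : ℕ} {E : Type*} [NormedAddCommGroup E] [NormedSpace ℝ E] {g : E → Mat n}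
    {x : E} (hg : ContDiffAt ℝ 1 g x) (i j : Fin n) : ContDiffAt ℝ 1 (fun y => g y i j) x :=
  (LinearMap.toContinuousLinearMap (Matrix.entryLinearMap ℝ ℝ i j)).contDiff.contDiffAt.comp x hg

/-- The only denominators are entries that are positive on `calW S`, hence nonzero in an ambient
neighbourhood. -/
theorem contDiffAt_opA {n : ℕ} (S : Spectrum n) {W : Mat n} (hW : W ∈ calW S) :
    ContDiffAt ℝ 1 (opA S) W := by
  have e : opA S = fun W => ∑ i, ∑ j, opA S W i j • Matrix.single i j (1 : ℝ) := by
    funext W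
    conv_lhs => rw [Matrix.matrix_eq_sum_single (opA S W)]
    simp [Matrix.smul_single]
  rw [e]
  refine ContDiffAt.sum fun i _ => ContDiffAt.sum fun j _ => ContDiffAt.fun_smul ?_ contDiffAt_const
  by_cases h : I2 S j i
  · simp only [opA, Matrix.of_apply, h, if_true]
    exact contDiffAt_const.div (contDiffAt_entry contDiffAt_id j i) (hW.2 j i h).ne'
  · simp only [opA, Matrix.of_apply, h, if_false]
    exact contDiffAt_const

theorem contDiffAt_F {n : ℕ} (S : Spectrum n) (Z : ZMan S) : ContDiffAt ℝ 1 (F S) Z.1 := by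
  have hQ : ContDiffAt ℝ 1 (fun Z : Amb n => Z.2.1) Z.1 := by fun_prop
  have hT : ContDiffAt ℝ 1 (fun Z : Amb n => Z.2.1ᵀ) Z.1 :=
    (LinearMap.toContinuousLinearMap
      (Matrix.transposeLinearEquiv (Fin n) (Fin n) ℝ ℝ).toLinearMap).contDiff.contDiffAt.comp Z.1 hQ
  have hA : ContDiffAt ℝ 1 (fun Z : Amb n => opA S Z.2.2.1) Z.1 :=
    ContDiffAt.comp (f := fun Z : Amb n => Z.2.2.1) Z.1 (contDiffAt_opA S Z.2.2.2.1) (by fun_prop)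
  have hM : ContDiffAt ℝ 1 (fun Z : Amb n => Lam S + opA S Z.2.2.1 + Z.2.2.1 + Z.2.2.2) Z.1 :=
    ((contDiffAt_const.add hA).add (by fun_prop)).add (by fun_prop)
  exact ContDiffAt.sub (by fun_prop) ((hQ.mul hM).mul hT)

theorem merit_eq {n : ℕ} (S : Spectrum n) :
    merit S = fun Z => 1 / 2 * ∑ i, ∑ j, F S Z i j * F S Z i j := by
  funext Z
  rw [← frob_apply, frob_self_eq_norm_sq, merit]

theorem contDiffAt_merit {n : ℕ} (S : Spectrum n) (Z : ZMan S) : ContDiffAt ℝ 1 (merit S) Z.1 := by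
  rw [merit_eq]
  have h := contDiffAt_F S Z
  exact contDiffAt_const.mul (ContDiffAt.sum fun i _ => ContDiffAt.sum fun j _ =>
    (contDiffAt_entry h i j).mul (contDiffAt_entry h i j))

theorem fderiv_merit {n : ℕ} (S : Spectrum n) (Z : ZMan S) (η : Amb n) :
    fderiv ℝ (merit S) Z.1 η = frob n (F S Z.1) (fderiv ℝ (F S) Z.1 η) := by
  have h := ((contDiffAt_F S Z).differentiableAt one_ne_zero).hasFDerivAt
  have he : ∀ i j, HasFDerivAt (fun Y => F S Y i j)
      ((LinearMap.toContinuousLinearMap (Matrix.entryLinearMap ℝ ℝ i j)).comp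
        (fderiv ℝ (F S) Z.1)) Z.1 := fun i j =>
    (LinearMap.toContinuousLinearMap (Matrix.entryLinearMap ℝ ℝ i j)).hasFDerivAt.comp Z.1 h
  have h1 := (HasFDerivAt.fun_sum fun i (_ : i ∈ Finset.univ) => HasFDerivAt.fun_sum
    fun j (_ : j ∈ Finset.univ) => (he i j).mul (he i j)).const_mul (1 / 2)
  have h2 := h1.congr_of_eventuallyEq (f₁ := merit S)
    (Eventually.of_forall fun y => congrFun (merit_eq S) y)
  refine (DFunLike.congr_fun h2.fderiv η).trans ?_
  rw [frob_apply]
  simp only [_root_.smul_apply, _root_.sum_apply, _root_.add_apply, smul_eq_mul, Finset.mul_sum]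
  refine Finset.sum_congr rfl fun i _ => Finset.sum_congr rfl fun j _ => ?_
  change 1 / 2 * (F S Z.1 i j * (fderiv ℝ (F S) Z.1 η) i j
    + F S Z.1 i j * (fderiv ℝ (F S) Z.1 η) i j) = _
  ring

theorem gradf_eq_DFadj {n : ℕ} (S : Spectrum n) (Z : ZMan S) :
    gradf S Z = DFadj S Z (F S Z.1) := by
  simp only [gradf, DFadj, LinearMap.comp_apply, LinearEquiv.coe_coe]
  congr 1
  ext η
  exact fderiv_merit S Z η

/-! ### Continuity in the base point -/

section

variable {n : ℕ} {S : Spectrum n} {ι : Type*} {l : Filter ι} {Z : ι → ZMan S} {Z₀ : ZMan S}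

theorem tendsto_F (hZ : Tendsto Z l (𝓝 Z₀)) :
    Tendsto (fun k => F S (Z k).1) l (𝓝 (F S Z₀.1)) :=
  (contDiffAt_F S Z₀).continuousAt.tendsto.comp ((continuous_subtype_val.tendsto _).comp hZ)

theorem tendsto_fderiv_F (hZ : Tendsto Z l (𝓝 Z₀)) {ξ : ι → Amb n} {ξ₀ : Amb n}
    (hξ : Tendsto ξ l (𝓝 ξ₀)) :
    Tendsto (fun k => fderiv ℝ (F S) (Z k).1 (ξ k)) l (𝓝 (fderiv ℝ (F S) Z₀.1 ξ₀)) :=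
  (isBoundedBilinearMap_apply.continuous.tendsto (fderiv ℝ (F S) Z₀.1, ξ₀)).comp
    ((((contDiffAt_F S Z₀).continuousAt_fderiv one_ne_zero).tendsto.comp
      ((continuous_subtype_val.tendsto _).comp hZ)).prodMk_nhds hξ)

theorem tendsto_frob {A B : ι → Mat n} {A₀ B₀ : Mat n} (hA : Tendsto A l (𝓝 A₀))
    (hB : Tendsto B l (𝓝 B₀)) : Tendsto (fun k => frob n (A k) (B k)) l (𝓝 (frob n A₀ B₀)) := by
  simp only [frob_apply]
  exact tendsto_finsetSum _ fun i _ => tendsto_finsetSum _ fun j _ =>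
    (tendsto_mat_iff.1 hA i j).mul (tendsto_mat_iff.1 hB i j)

theorem tendsto_metric (hZ : Tendsto Z l (𝓝 Z₀)) {ξ η : ∀ k, Tan S (Z k)} {ξ₀ η₀ : Tan S Z₀}
    (hξ : Tendsto (fun k => (ξ k).1) l (𝓝 ξ₀.1)) (hη : Tendsto (fun k => (η k).1) l (𝓝 η₀.1)) :
    Tendsto (fun k => metric S (Z k) (ξ k) (η k)) l (𝓝 (metric S Z₀ ξ₀ η₀)) := by
  have hZ' : Tendsto (fun k => (Z k).1) l (𝓝 Z₀.1) := (continuous_subtype_val.tendsto _).comp hZ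
  simp only [metric_apply]
  refine (((tendsto_finsetSum _ fun i _ => tendsto_finsetSum _ fun j _ => ?_).add ?_).add
    (tendsto_finsetSum _ fun i _ => tendsto_finsetSum _ fun j _ => ?_)).add ?_
  · exact ((tendsto_mat_iff.1 hξ.fst_nhds i j).mul (tendsto_mat_iff.1 hη.fst_nhds i j)).div
      (tendsto_mat_iff.1 hZ'.fst_nhds i j) (Z₀.2.1.1 i j).ne'
  · exact tendsto_frob hξ.snd_nhds.fst_nhds hη.snd_nhds.fst_nhds
  · split_ifs with h
    · exact ((tendsto_mat_iff.1 hξ.snd_nhds.snd_nhds.fst_nhds i j).mul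
        (tendsto_mat_iff.1 hη.snd_nhds.snd_nhds.fst_nhds i j)).div
        (tendsto_mat_iff.1 hZ'.snd_nhds.snd_nhds.fst_nhds i j) (Z₀.2.2.2.1.2 i j h).ne'
    · exact tendsto_const_nhds
  · exact tendsto_frob hξ.snd_nhds.snd_nhds.snd_nhds hη.snd_nhds.snd_nhds.snd_nhds

/-- Every tangent vector is a limit of tangent vectors at converging base points. -/
theorem exists_tangent_tendsto (hZ : Tendsto Z l (𝓝 Z₀)) (η₀ : Tan S Z₀) :
    ∃ η : ∀ k, Tan S (Z k), Tendsto (fun k => (η k).1) l (𝓝 η₀.1) := by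
  have hZ' : Tendsto (fun k => (Z k).1) l (𝓝 Z₀.1) := (continuous_subtype_val.tendsto _).comp hZ
  obtain ⟨⟨C, Q, W, V⟩, hC, ⟨K, hK, hQ⟩, hW, hV⟩ := η₀
  obtain rfl : Q = _ := hQ
  refine ⟨fun k => ⟨(C, (Z k).1.2.1 * K, W, V), hC, ⟨K, hK, rfl⟩, hW, hV⟩, ?_⟩
  exact tendsto_const_nhds.prodMk_nhds ((hZ'.snd_nhds.fst_nhds.mul_const K).prodMk_nhds
    (tendsto_const_nhds.prodMk_nhds tendsto_const_nhds))

/-- Limits of tangent vectors are tangent at the limit of the base points. -/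
theorem mem_Tan_of_tendsto [l.NeBot] (hZ : Tendsto Z l (𝓝 Z₀)) {ξ : ∀ k, Tan S (Z k)}
    {ξ₀ : Amb n} (hξ : Tendsto (fun k => (ξ k).1) l (𝓝 ξ₀)) : ξ₀ ∈ Tan S Z₀ := by
  have hZ' : Tendsto (fun k => (Z k).1) l (𝓝 Z₀.1) := (continuous_subtype_val.tendsto _).comp hZ
  have x1 := tendsto_mat_iff.1 hξ.fst_nhds
  have x2 := hξ.snd_nhds.fst_nhds
  have x3 := tendsto_mat_iff.1 hξ.snd_nhds.snd_nhds.fst_nhds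
  have x4 := tendsto_mat_iff.1 hξ.snd_nhds.snd_nhds.snd_nhds
  refine ⟨⟨fun i => ?_, fun j => ?_⟩, ?_, fun i j h => ?_, fun i j h => ?_⟩
  · refine tendsto_nhds_unique (tendsto_finsetSum _ fun j _ => x1 i j) ?_
    exact tendsto_const_nhds.congr fun k => ((ξ k).2.1.1 i).symm
  · refine tendsto_nhds_unique (tendsto_finsetSum _ fun i _ => x1 i j) ?_
    exact tendsto_const_nhds.congr fun k => ((ξ k).2.1.2 j).symm
  · have hT : Tendsto (fun k => (Z k).1.2.1ᵀ * (ξ k).1.2.1) l (𝓝 (Z₀.1.2.1ᵀ * ξ₀.2.1)) :=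
      ((continuous_id.matrix_transpose.tendsto _).comp hZ'.snd_nhds.fst_nhds).mul x2
    have hT' := (continuous_id.matrix_transpose.tendsto _).comp hT
    have hQ : Z₀.1.2.1 * Z₀.1.2.1ᵀ = 1 := mul_eq_one_comm.1 Z₀.2.2.1
    refine ⟨Z₀.1.2.1ᵀ * ξ₀.2.1, tendsto_nhds_unique hT' (hT.neg.congr fun k => ?_), ?_⟩
    · obtain ⟨K, hK, h⟩ := (ξ k).2.2.1
      have hQk : (Z k).1.2.1ᵀ * (Z k).1.2.1 = 1 := (Z k).2.2.1
      simp only [Function.comp_apply, id]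
      rw [h, ← mul_assoc, hQk, one_mul, hK]
    · rw [← mul_assoc, hQ, one_mul]
  · exact tendsto_nhds_unique (x3 i j) (tendsto_const_nhds.congr fun k => ((ξ k).2.2.2.1 i j h).symm)
  · exact tendsto_nhds_unique (x4 i j) (tendsto_const_nhds.congr fun k => ((ξ k).2.2.2.2 i j h).symm)

/-- The directional derivative of the merit function along the retraction. -/
theorem tendsto_merit_retr {t : ι → ℝ} (ht : Tendsto t l (𝓝 0)) (htpos : ∀ᶠ k in l, 0 < t k)
    (hZ : Tendsto Z l (𝓝 Z₀)) {ξ : ∀ k, Tan S (Z k)} {ξ₀ : Amb n}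
    (hξ : Tendsto (fun k => (ξ k).1) l (𝓝 ξ₀)) :
    Tendsto (fun k => (t k)⁻¹ * (merit S (retr S (Z k) (t k • ξ k)) - merit S (Z k).1)) l
      (𝓝 (fderiv ℝ (merit S) Z₀.1 ξ₀)) := by
  have hZ' : Tendsto (fun k => (Z k).1) l (𝓝 Z₀.1) := (continuous_subtype_val.tendsto _).comp hZ
  have hq := tendsto_retr_sub S ht htpos hZ hξ
  set q : ι → Amb n := fun k => (t k)⁻¹ • (retr S (Z k) (t k • ξ k) - (Z k).1) with hqdef
  have hR : ∀ᶠ k in l, retr S (Z k) (t k • ξ k) = (Z k).1 + t k • q k := by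
    filter_upwards [htpos] with k hk
    rw [hqdef, smul_inv_smul₀ hk.ne', add_sub_cancel]
  have hRt : Tendsto (fun k => (Z k).1 + t k • q k) l (𝓝 Z₀.1) := by
    simpa using hZ'.add (ht.smul hq)
  -- Strict differentiability is what permits both endpoints of the difference to move towards `Z₀`.
  have hs := (contDiffAt_merit S Z₀).hasStrictFDerivAt one_ne_zero
  have hO : (fun k => ((Z k).1 + t k • q k) - (Z k).1) =O[l] t := by
    simpa only [add_sub_cancel_left, smul_eq_mul, mul_one] using
      (Asymptotics.isBigO_refl t l).smul (hq.isBigO_one ℝ)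
  have ho := (hs.isLittleO.comp_tendsto (hRt.prodMk_nhds hZ')).trans_isBigO hO
  have h0 := ho.tendsto_div_nhds_zero
  have hlin := ((fderiv ℝ (merit S) Z₀.1).continuous.tendsto ξ₀).comp hq
  have := h0.add hlin
  rw [zero_add] at this
  refine this.congr' ?_
  filter_upwards [hR, htpos] with k hk hk0
  have e : fderiv ℝ (merit S) Z₀.1 (t k • q k) = t k * fderiv ℝ (merit S) Z₀.1 (q k) :=
    (fderiv ℝ (merit S) Z₀.1).map_smul _ _
  simp only [Function.comp_apply, add_sub_cancel_left]
  have e' : ∀ d x y : ℝ, x = t k * y → (d - x) / t k + y = (t k)⁻¹ * d := by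
    rintro d _ y rfl
    rw [div_eq_inv_mul, mul_sub, inv_mul_cancel_left₀ hk0.ne', sub_add_cancel]
  rw [hk]
  exact e' _ _ _ e

end

/-- Coercivity of the metric. -/
theorem norm_sq_le_metric {n : ℕ} {S : Spectrum n} (Z : ZMan S) {B : ℝ} (hB : 1 ≤ B)
    (hW : ∀ i j, Z.1.2.2.1 i j ≤ B) (ξ : Tan S Z) : ‖ξ.1‖ ^ 2 ≤ B * metric S Z ξ ξ := by
  classical
  obtain ⟨⟨hC, hC1, -⟩, -, ⟨-, hWp⟩, -⟩ := Z.2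
  have hB0 : 0 < B := by linarith
  have hC1 : ∀ i j, Z.1.1 i j ≤ 1 := fun i j => by
    rw [← hC1 i]
    exact Finset.single_le_sum (f := fun j => Z.1.1 i j) (fun j _ => (hC i j).le)
      (Finset.mem_univ j)
  -- Double stochasticity gives `c_ij ≤ 1`, so the Fisher weights on this component are at least
  -- one; on `𝒲` they are at least `1 / B`.
  have q1 : ‖ξ.1.1‖ ^ 2 ≤ ∑ i, ∑ j, ξ.1.1 i j * ξ.1.1 i j / Z.1.1 i j := by
    rw [← frob_self_eq_norm_sq, frob_apply]
    exact Finset.sum_le_sum fun i _ => Finset.sum_le_sum fun j _ =>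
      le_div_self (mul_self_nonneg _) (hC i j) (hC1 i j)
  have q3 : ‖ξ.1.2.2.1‖ ^ 2 ≤ B * ∑ i, ∑ j,
      if I2 S i j then ξ.1.2.2.1 i j * ξ.1.2.2.1 i j / Z.1.2.2.1 i j else 0 := by
    rw [← frob_self_eq_norm_sq, frob_apply, Finset.mul_sum]
    refine Finset.sum_le_sum fun i _ => ?_
    rw [Finset.mul_sum]
    refine Finset.sum_le_sum fun j _ => ?_
    split_ifs with h
    · rw [← mul_div_assoc, le_div_iff₀ (hWp i j h), mul_comm B]
      exact mul_le_mul_of_nonneg_left (hW i j) (mul_self_nonneg _)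
    · rw [ξ.2.2.2.1 i j h]; simp
  have q2 := frob_self_eq_norm_sq ξ.1.2.1
  have q4 := frob_self_eq_norm_sq ξ.1.2.2.2
  rw [metric_apply]
  set s1 := ∑ i, ∑ j, ξ.1.1 i j * ξ.1.1 i j / Z.1.1 i j
  set s3 := ∑ i, ∑ j, if I2 S i j then ξ.1.2.2.1 i j * ξ.1.2.2.1 i j / Z.1.2.2.1 i j else 0
  rw [q2, q4]
  have p1 := sq_nonneg ‖ξ.1.1‖
  have p2 := sq_nonneg ‖ξ.1.2.1‖
  have p3 := sq_nonneg ‖ξ.1.2.2.1‖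
  have p4 := sq_nonneg ‖ξ.1.2.2.2‖
  have p3' : 0 ≤ s3 := nonneg_of_mul_nonneg_right (p3.trans q3) hB0
  -- The ambient product carries the maximum norm, so bounding each component is enough.
  have b1 : ‖ξ.1‖ ≤ √(B * (s1 + ‖ξ.1.2.1‖ ^ 2 + s3 + ‖ξ.1.2.2.2‖ ^ 2)) := by
    refine norm_prod_le_iff.2 ⟨?_, norm_prod_le_iff.2 ⟨?_, norm_prod_le_iff.2 ⟨?_, ?_⟩⟩⟩ <;>
      refine Real.le_sqrt_of_sq_le ?_ <;> nlinarith
  calc ‖ξ.1‖ ^ 2 ≤ √(B * (s1 + ‖ξ.1.2.1‖ ^ 2 + s3 + ‖ξ.1.2.2.2‖ ^ 2)) ^ 2 := by gcongr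
    _ = _ := Real.sq_sqrt (mul_nonneg hB0.le (by linarith))

/-! ### Search directions -/

theorem metric_self_nonneg {n : ℕ} {S : Spectrum n} (Z : ZMan S) (ξ : Tan S Z) :
    0 ≤ metric S Z ξ ξ := by
  obtain ⟨B, hB⟩ : ∃ B : ℝ, ∀ i j, Z.1.2.2.1 i j ≤ B :=
    ⟨‖Z.1.2.2.1‖, fun i j => (le_abs_self _).trans (abs_entry_le_norm _ i j)⟩
  have h := norm_sq_le_metric Z (le_max_left 1 B) (fun i j => (hB i j).trans (le_max_right 1 B)) ξ
  exact nonneg_of_mul_nonneg_right ((sq_nonneg _).trans h) (lt_max_of_lt_left one_pos)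

/-- The residual of the regularized equation controls its solution. -/
theorem metric_add_le_of_residual {n : ℕ} {S : Spectrum n} (Z : ZMan S) (Y G : Mat n) (σ : ℝ) :
    metric S Z (DFadj S Z Y) (DFadj S Z Y) + σ * ‖Y‖ ^ 2 ≤
      (‖DF S Z (DFadj S Z Y) + σ • Y + G‖ + ‖G‖) * ‖Y‖ := by
  have h : metric S Z (DFadj S Z Y) (DFadj S Z Y) + σ * ‖Y‖ ^ 2 =
      frob n Y ((DF S Z (DFadj S Z Y) + σ • Y + G) + -G) := by
    rw [metric_DFadj, add_neg_cancel_right, map_add, map_smul, smul_eq_mul, frob_self_eq_norm_sq]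
  rw [h, mul_comm]
  refine (frob_le_norm_mul_norm _ _).trans ?_
  gcongr
  exact (norm_add_le _ _).trans_eq (by rw [norm_neg])

/-- An exact solution of the regularized equation gives a descent direction unless the point is
stationary. -/
theorem stationary_or_descent {n : ℕ} {S : Spectrum n} (Z : ZMan S) {Y : Mat n} {σ : ℝ}
    (hσ : 0 < σ) (h : DF S Z (DFadj S Z Y) + σ • Y + F S Z.1 = 0) :
    DFadj S Z (F S Z.1) = 0 ∨ frob n (F S Z.1) (DF S Z (DFadj S Z Y)) < 0 := by
  have hF : F S Z.1 = -(DF S Z (DFadj S Z Y) + σ • Y) := (neg_eq_of_add_eq_zero_right h).symm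
  by_cases h0 : DFadj S Z Y = 0
  · left
    rw [hF, h0, map_zero, zero_add, map_neg, map_smul, h0, smul_zero, neg_zero]
  · right
    -- With `D = DFadj S Z Y`, substituting the equation for `F` gives `⟨F, DF D⟩ = -‖DF D‖² - σ ⟨D,
    -- D⟩`.
    have hpos : 0 < metric S Z (DFadj S Z Y) (DFadj S Z Y) :=
      (metric_self_nonneg Z _).lt_of_ne' fun h1 => h0 (metric_definite S Z _ h1)
    have hY := metric_DFadj S Z Y (DFadj S Z Y)
    have h2 := frob_self_nonneg (DF S Z (DFadj S Z Y))
    conv_lhs => rw [hF]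
    rw [map_neg, map_add, map_smul, LinearMap.neg_apply, LinearMap.add_apply, LinearMap.smul_apply,
      ← hY, smul_eq_mul]
    nlinarith [mul_pos hσ hpos]

/-- Inexact solutions of the regularized equations subconverge to an exact solution of the limiting
equation, together with the corresponding search directions. -/
theorem exists_subseq_tendsto_direction {n : ℕ} {S : Spectrum n} {Z : ℕ → ZMan S} {Z₀ : ZMan S}
    (hZ : Tendsto Z atTop (𝓝 Z₀)) {Y : ℕ → Mat n} {σ : ℕ → ℝ} {σ₀ : ℝ}
    (hσ : Tendsto σ atTop (𝓝 σ₀)) (hσ₀ : 0 < σ₀)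
    (hres : Tendsto (fun k => DF S (Z k) (DFadj S (Z k) (Y k)) + σ k • Y k + F S (Z k).1) atTop
      (𝓝 0)) :
    ∃ (Y₀ : Mat n) (φ : ℕ → ℕ), StrictMono φ ∧
      Tendsto (fun k => (DFadj S (Z (φ k)) (Y (φ k))).1) atTop (𝓝 (DFadj S Z₀ Y₀).1) ∧
      DF S Z₀ (DFadj S Z₀ Y₀) + σ₀ • Y₀ + F S Z₀.1 = 0 := by
  have hZ' : Tendsto (fun k => (Z k).1) atTop (𝓝 Z₀.1) :=
    (continuous_subtype_val.tendsto _).comp hZ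
  set D := fun k => DFadj S (Z k) (Y k) with hD
  obtain ⟨b, hb⟩ : ∃ b : ℝ, ∀ᶠ k in atTop, ‖Y k‖ ≤ b ∧ ‖(D k).1‖ ≤ b := by
    -- Eventually `c` bounds residual norm plus `‖F‖`, `B` bounds the entries of `W`, and `σ k > σ₀
    -- / 2`. The energy estimate then yields `‖Y‖ ≤ 2c / σ₀`, and coercivity bounds the direction.
    let c := ‖F S Z₀.1‖ + 2
    let B := max 1 (‖Z₀.1.2.2.1‖ + 1)
    have hc : 0 < c := by positivity
    refine ⟨max (2 * c / σ₀) √(B * (c * (2 * c / σ₀))), ?_⟩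
    have e1 := (tendsto_order.1 hres.norm).2 1 (by simp)
    have e2 := (tendsto_order.1 (tendsto_F hZ).norm).2 (‖F S Z₀.1‖ + 1) (by linarith)
    have e3 := (tendsto_order.1 hσ).1 (σ₀ / 2) (by linarith)
    have e4 := (tendsto_order.1 hZ'.snd_nhds.snd_nhds.fst_nhds.norm).2 (‖Z₀.1.2.2.1‖ + 1)
      (by linarith)
    filter_upwards [e1, e2, e3, e4] with k h1 h2 h3 h4
    have hm := metric_add_le_of_residual (Z k) (Y k) (F S (Z k).1) (σ k)
    have hm0 := metric_self_nonneg (Z k) (DFadj S (Z k) (Y k))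
    have hle : metric S (Z k) (D k) (D k) + σ k * ‖Y k‖ ^ 2 ≤ c * ‖Y k‖ :=
      hm.trans (mul_le_mul_of_nonneg_right (by linarith) (norm_nonneg _))
    have hY : ‖Y k‖ ≤ 2 * c / σ₀ := by
      rw [le_div_iff₀ hσ₀]
      rcases (norm_nonneg (Y k)).eq_or_lt with h0 | h0
      · rw [← h0]; linarith
      · refine le_of_mul_le_mul_left ?_ h0
        nlinarith [mul_pos h0 h0]
    refine ⟨hY.trans (le_max_left _ _), le_max_of_le_right (Real.le_sqrt_of_sq_le ?_)⟩
    refine (norm_sq_le_metric (Z k) (le_max_left 1 (‖Z₀.1.2.2.1‖ + 1)) (fun i j => ?_) _).trans ?_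
    · exact ((le_abs_self _).trans (abs_entry_le_norm _ i j)).trans
        (h4.le.trans (le_max_right _ _))
    · have hs : 0 ≤ σ k * ‖Y k‖ ^ 2 := mul_nonneg (by linarith) (sq_nonneg _)
      have : metric S (Z k) (D k) (D k) ≤ c * (2 * c / σ₀) :=
        (by linarith : metric S (Z k) (D k) (D k) ≤ c * ‖Y k‖).trans (by gcongr)
      exact mul_le_mul_of_nonneg_left this (zero_le_one.trans (le_max_left _ _))
  have : ProperSpace (Mat n) := FiniteDimensional.proper_real _
  obtain ⟨⟨Y₀, ξ₀⟩, -, φ, hφ, hlim⟩ := tendsto_subseq_of_frequently_bounded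
    (x := fun k => (Y k, (D k).1)) (Metric.isBounded_closedBall (x := 0) (r := b))
    (hb.mono fun k hk => by
      rw [mem_closedBall_zero_iff]
      exact norm_prod_le_iff.2 hk).frequently
  have hY : Tendsto (fun k => Y (φ k)) atTop (𝓝 Y₀) := hlim.fst_nhds
  have hξ : Tendsto (fun k => (D (φ k)).1) atTop (𝓝 ξ₀) := hlim.snd_nhds
  have hZφ := hZ.comp hφ.tendsto_atTop
  have hmem : ξ₀ ∈ Tan S Z₀ := mem_Tan_of_tendsto hZφ hξ
  -- The tangent spaces vary, so continuity of the adjoint is obtained weakly: the defining identity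
  -- is tested on tangent vectors converging to an arbitrary `η₀`, and the metric at `Z₀` is
  -- nondegenerate.
  have hDF : DFadj S Z₀ Y₀ = ⟨ξ₀, hmem⟩ := by
    rw [← sub_eq_zero]
    refine (metric_nondegenerate S Z₀).1 _ fun η₀ => ?_
    obtain ⟨η, hη⟩ := exists_tangent_tendsto hZφ η₀
    have h1 := tendsto_metric (ξ₀ := ⟨ξ₀, hmem⟩) hZφ hξ hη
    have h2 := tendsto_frob hY (tendsto_fderiv_F hZφ hη)
    rw [map_sub, LinearMap.sub_apply, metric_DFadj, sub_eq_zero]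
    refine tendsto_nhds_unique h2 (h1.congr fun k => ?_)
    exact metric_DFadj S _ _ _
  refine ⟨Y₀, φ, hφ, ?_, ?_⟩
  · rw [hDF]
    exact hξ
  · have h1 := ((tendsto_fderiv_F hZφ hξ).add ((hσ.comp hφ.tendsto_atTop).smul hY)).add
      (tendsto_F hZφ)
    rw [hDF]
    exact tendsto_nhds_unique h1 (hres.comp hφ.tendsto_atTop)

/-! ### The iteration -/

/-- The product of the factors `1 + γ_k` is at most `exp (∑ γ)`, so `u` has a bound `B`; subtracting
`B` times the partial sums of `γ` leaves a decreasing sequence that is bounded below. -/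
theorem tendsto_of_le_one_add_mul {u γ : ℕ → ℝ} (hu : ∀ k, 0 ≤ u k) (hγ : ∀ k, 0 < γ k)
    (hs : Summable γ) (h : ∀ k, u (k + 1) ≤ (1 + γ k) * u k) : ∃ L, Tendsto u atTop (𝓝 L) := by
  have hsum := fun k => hs.sum_le_tsum (Finset.range k) fun i _ => (hγ i).le
  have hb1 : ∀ k, u k ≤ u 0 * Real.exp (∑ i ∈ Finset.range k, γ i) := by
    intro k
    induction k with
    | zero => simp
    | succ k ih =>
      rw [Finset.sum_range_succ, Real.exp_add, ← mul_assoc, mul_comm]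
      refine (h k).trans ((mul_comm _ _).trans_le ?_)
      rw [mul_comm (Real.exp (γ k))]
      exact mul_le_mul ih (by linarith [Real.add_one_le_exp (γ k)]) (by linarith [hγ k])
        ((hu k).trans ih)
  set B := u 0 * Real.exp (∑' i, γ i) with hB
  have hb : ∀ k, u k ≤ B := fun k => (hb1 k).trans
    (mul_le_mul_of_nonneg_left (Real.exp_le_exp.2 (hsum k)) (hu 0))
  have hB0 : 0 ≤ B := (hu 0).trans (hb 0)
  have hanti : Antitone fun k => u k - B * ∑ i ∈ Finset.range k, γ i := by
    refine antitone_nat_of_succ_le fun k => ?_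
    rw [Finset.sum_range_succ]
    nlinarith [h k, hb k, hγ k, mul_le_mul_of_nonneg_left (hb k) (hγ k).le]
  have hbdd : BddBelow (Set.range fun k => u k - B * ∑ i ∈ Finset.range k, γ i) := by
    refine ⟨-(B * ∑' i, γ i), ?_⟩
    rintro _ ⟨k, rfl⟩
    have := mul_le_mul_of_nonneg_left (hsum k) hB0
    have := hu k
    simp only
    linarith
  have h1 := tendsto_atTop_ciInf hanti hbdd
  have h2 := hs.hasSum.tendsto_sum_nat.const_mul B
  exact ⟨_, (h1.add h2).congr fun k => by simp⟩

theorem norm_F_sq_succ_le {n : ℕ} {S : Spectrum n} {p : Params} {k : ℕ} {Z Z' : ZMan S}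
    {ξ : Tan S Z} {a : ℝ} (ha : IsStepsize S p k Z ξ a) (hZ' : Z'.1 = retr S Z (a • ξ)) :
    ‖F S Z'.1‖ ^ 2 ≤ (1 + p.γ k) * ‖F S Z.1‖ ^ 2 := by
  have hγ := mul_nonneg (p.γ_pos k).le (sq_nonneg ‖F S Z.1‖)
  by_cases hf : FullStep S p Z ξ
  · rw [ha.1 hf, one_smul] at hZ'
    have h : ‖F S Z'.1‖ ≤ ‖F S Z.1‖ := by
      rw [hZ']
      exact (show _ ≤ _ from hf).trans (mul_le_of_le_one_left (norm_nonneg _) p.τ_mem.2.le)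
    have := pow_le_pow_left₀ (norm_nonneg _) h 2
    linarith
  · have h : Decrease S p k Z ξ a := (ha.2 hf).1.2
    unfold Decrease at h
    rw [← hZ'] at h
    have := mul_nonneg (mul_nonneg p.δ_mem.1.le (sq_nonneg a))
      (abs_nonneg (metric S Z (gradf S Z) ξ))
    linarith

/-- A stepsize below one comes from a larger one that fails the decrease condition. -/
theorem not_decrease_div_of_lt_one {n : ℕ} {S : Spectrum n} {p : Params} {k : ℕ} {Z : ZMan S}
    {ξ : Tan S Z} {a : ℝ} (ha : IsStepsize S p k Z ξ a) (hf : ¬ FullStep S p Z ξ) (ha1 : a < 1) :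
    0 < a ∧ ¬ Decrease S p k Z ξ (a / p.ρ) := by
  obtain ⟨⟨⟨l, rfl⟩, -⟩, hmax⟩ := ha.2 hf
  have hρ := p.ρ_mem.1
  refine ⟨pow_pos hρ l, fun hd => ?_⟩
  -- Exponent zero would give `a = 1`; otherwise `a / ρ` is the preceding, larger power, excluded by
  -- maximality.
  obtain _ | l := l
  · simp at ha1
  · rw [pow_succ, mul_div_cancel_right₀ _ hρ.ne'] at hd
    have h1 := hmax ⟨⟨l, rfl⟩, hd⟩
    rw [pow_succ] at h1
    have := mul_lt_of_lt_one_right (pow_pos hρ l) p.ρ_mem.2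
    linarith

theorem stationary_of_mapClusterPt {n : ℕ} {S : Spectrum n} {p : Params} {Z : ℕ → ZMan S}
    (hZ : Generates S p Z) {Z₀ : ZMan S} (hacc : MapClusterPt Z₀ atTop Z) :
    DFadj S Z₀ (F S Z₀.1) = 0 := by
  by_cases hF0 : F S Z₀.1 = 0
  · rw [hF0, map_zero]
  have hc : 0 < ‖F S Z₀.1‖ := norm_pos_iff.2 hF0
  choose _ Y a hY ha hsucc using hZ
  have : FirstCountableTopology (Mat n) :=
    @UniformSpace.firstCountableTopology (Mat n) PseudoMetricSpace.toUniformSpace _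
  obtain ⟨φ, hφ, hφZ⟩ := hacc.tendsto_subseq
  set N := fun k => ‖F S (Z k).1‖ with hN
  set D := fun k => DFadj S (Z k) (Y k) with hD
  -- Convergence holds for the whole sequence; only the value of the limit is read off the
  -- subsequence.
  have hN0 : Tendsto N atTop (𝓝 ‖F S Z₀.1‖) := by
    obtain ⟨L, hL⟩ := tendsto_of_le_one_add_mul (u := fun k => N k ^ 2) (fun k => sq_nonneg _)
      p.γ_pos p.γ_summable fun k => norm_F_sq_succ_le (ha k) (hsucc k)
    have h1 : Tendsto N atTop (𝓝 √L) :=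
      (hL.sqrt).congr fun k => Real.sqrt_sq (norm_nonneg _)
    rwa [tendsto_nhds_unique (h1.comp hφ.tendsto_atTop) (tendsto_F hφZ).norm] at h1
  have hfull : ∀ᶠ k in atTop, ¬ FullStep S p (Z k) (D k) := by
    by_contra hcon
    have hfr : ∃ᶠ k in atTop, N (k + 1) ≤ p.τ * N k := by
      refine (not_eventually.1 hcon).mono fun k hk => ?_
      have hf : FullStep S p (Z k) (D k) := not_not.1 hk
      have h1 := hsucc k
      rw [(ha k).1 hf, one_smul] at h1
      simp only [hN, h1]
      exact hf
    have h2 := le_of_tendsto_of_tendsto_of_frequently ((tendsto_add_atTop_iff_nat 1).2 hN0)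
      (hN0.const_mul p.τ) hfr
    nlinarith [p.τ_mem.2]
  set g := fun k => |metric S (Z k) (gradf S (Z k)) (D k)| with hg
  -- Consecutive values of the convergent `N` differ by a null sequence, and `γ` tends to zero.
  have hsq : Tendsto (fun k => a k ^ 2 * g k) atTop (𝓝 0) := by
    have hb : Tendsto (fun k => p.δ⁻¹ * (N k ^ 2 - N (k + 1) ^ 2 + p.γ k * N k ^ 2)) atTop
        (𝓝 0) := by
      have := (((hN0.pow 2).sub (((tendsto_add_atTop_iff_nat 1).2 hN0).pow 2)).add
        (p.γ_summable.tendsto_atTop_zero.mul (hN0.pow 2))).const_mul p.δ⁻¹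
      simpa using this
    refine squeeze_zero' (Eventually.of_forall fun k => mul_nonneg (sq_nonneg _) (abs_nonneg _)) ?_ hb
    filter_upwards [hfull] with k hk
    have h : Decrease S p k (Z k) (D k) (a k) := ((ha k).2 hk).1.2
    unfold Decrease at h
    rw [← hsucc k] at h
    rw [le_inv_mul_iff₀ p.δ_mem.1]
    simp only [hN, hg]
    linarith
  have hσ : Tendsto (fun k => sigmaBar S p (Z (φ k))) atTop (𝓝 (min p.σmax ‖F S Z₀.1‖)) :=
    tendsto_const_nhds.min (hN0.comp hφ.tendsto_atTop)
  have hσ0 : 0 < min p.σmax ‖F S Z₀.1‖ := lt_min p.σmax_mem.1 hc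
  have hres : Tendsto (fun k => DF S (Z k) (DFadj S (Z k) (Y k)) + sigmaBar S p (Z k) • Y k
      + F S (Z k).1) atTop (𝓝 0) := by
    have hb : Tendsto (fun k => p.η k * N k) atTop (𝓝 0) := by
      simpa using p.η_tendsto.mul hN0
    refine squeeze_zero_norm (fun k => ?_) hb
    exact (show _ ≤ _ from hY k).trans
      (mul_le_mul_of_nonneg_right (min_le_left _ _) (norm_nonneg _))
  obtain ⟨Y₀, ψ, hψ, hξ, heq⟩ := exists_subseq_tendsto_direction (Y := fun k => Y (φ k)) hφZ hσ hσ0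
    (hres.comp hφ.tendsto_atTop)
  refine (stationary_or_descent Z₀ hσ0 heq).resolve_right fun hneg => ?_
  have hθ : Tendsto (fun k => φ (ψ k)) atTop atTop := hφ.tendsto_atTop.comp hψ.tendsto_atTop
  have hZθ : Tendsto (fun k => Z (φ (ψ k))) atTop (𝓝 Z₀) := hφZ.comp hψ.tendsto_atTop
  set v := frob n (F S Z₀.1) (DF S Z₀ (DFadj S Z₀ Y₀)) with hv
  have hgv : Tendsto (fun k => g (φ (ψ k))) atTop (𝓝 |v|) := by
    refine ((tendsto_frob (tendsto_F hZθ) (tendsto_fderiv_F hZθ hξ)).abs).congr fun k => ?_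
    simp only [hg, metric_gradf, fderiv_merit]
    rfl
  have hv0 : 0 < |v| := abs_pos.2 hneg.ne
  have ha0 : Tendsto (fun k => a (φ (ψ k))) atTop (𝓝 0) := by
    have h1 : Tendsto (fun k => a (φ (ψ k)) ^ 2) atTop (𝓝 0) := by
      have h := (hsq.comp hθ).div hgv hv0.ne'
      rw [zero_div] at h
      refine h.congr' ?_
      filter_upwards [hgv.eventually (lt_mem_nhds hv0)] with k hk
      exact mul_div_cancel_right₀ _ hk.ne'
    have h2 := h1.sqrt
    simp only [Real.sqrt_sq_eq_abs, Real.sqrt_zero] at h2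
    exact (tendsto_zero_iff_abs_tendsto_zero _).2 h2
  have hstep : ∀ᶠ k in atTop, 0 < a (φ (ψ k)) ∧
      ¬ Decrease S p (φ (ψ k)) (Z (φ (ψ k))) (D (φ (ψ k))) (a (φ (ψ k)) / p.ρ) := by
    filter_upwards [hθ.eventually hfull, ha0.eventually (gt_mem_nhds one_pos)] with k h1 h2
    exact not_decrease_div_of_lt_one (ha _) h1 h2
  set t := fun k => a (φ (ψ k)) / p.ρ with ht
  have ht0 : Tendsto t atTop (𝓝 0) := by simpa using ha0.div_const p.ρ
  have htpos : ∀ᶠ k in atTop, 0 < t k := hstep.mono fun k hk => div_pos hk.1 p.ρ_mem.1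
  have hlim := tendsto_merit_retr ht0 htpos hZθ hξ
  rw [fderiv_merit] at hlim
  have hlow : Tendsto (fun k => -(p.δ / 2) * (t k * g (φ (ψ k)))) atTop (𝓝 0) := by
    simpa using (ht0.mul hgv).const_mul (-(p.δ / 2))
  -- The nonnegative `γ` term is dropped from the failed test. Dividing by `t` leaves a lower bound
  -- of order `t`, which vanishes in the limit; `δ / 2` reflects the factor one half in `merit`.
  have hle : 0 ≤ v := by
    refine le_of_tendsto_of_tendsto hlow hlim ?_
    filter_upwards [hstep, htpos] with k hk htk
    have h := hk.2
    unfold Decrease at h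
    rw [not_le] at h
    have hγ := mul_nonneg (p.γ_pos (φ (ψ k))).le (sq_nonneg ‖F S (Z (φ (ψ k))).1‖)
    rw [le_inv_mul_iff₀ htk]
    simp only [merit]
    have e : t k * (-(p.δ / 2) * (t k * g (φ (ψ k)))) = 1 / 2 * (-p.δ * t k ^ 2 * g (φ (ψ k))) := by
      ring
    rw [e]
    change _ < ‖F S (retr S (Z (φ (ψ k))) (t k • D (φ (ψ k))))‖ ^ 2 - _ at h
    change -p.δ * t k ^ 2 * g (φ (ψ k)) + _ < _ at h
    change _ ≤ 1 / 2 * ‖F S (retr S (Z (φ (ψ k))) (t k • D (φ (ψ k))))‖ ^ 2 - _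
    linarith
  linarith

end PDStIEP

end

theorem mainTheorem1 (n : ℕ) (S : PDStIEP.Spectrum n) (p : PDStIEP.Params)
    (Z : ℕ → PDStIEP.ZMan S) (hZ : PDStIEP.Generates S p Z)
    (Zstar : PDStIEP.ZMan S) (hacc : MapClusterPt Zstar Filter.atTop Z) :
    PDStIEP.gradf S Zstar = PDStIEP.DFadj S Zstar (PDStIEP.F S Zstar.1) ∧
      PDStIEP.DFadj S Zstar (PDStIEP.F S Zstar.1) = 0 :=
  ⟨PDStIEP.gradf_eq_DFadj S Zstar, PDStIEP.stationary_of_mapClusterPt hZ hacc⟩
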